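/- Let $X$ and $Y$ be metric spaces, let $C\ge 0$, and assume that $X$ is $C$-quasi-convex: any two points $x,x'\in X$ are joined by a curve of length at most $C\,d_X(x,x')$. Assume that $H_1(X)=0$ or $H_1^{\mathrm{Lip}}(X)=0$ (singular, respectively singular Lipschitz, homology with integer coefficients). Let $\sigma:[0,\infty)\to[0,\infty)$ be continuous and strictly increasing with $\sigma(0)=0$, and let $\varphi:X\to Y$ satisfy $d_Y(\varphi(x),\varphi(x'))\le\sigma(d_X(x,x'))$ for all $x,x'\in X$, together with Property (T): for all $x,x'\in X$ with $\varphi(x)\ne\varphi(x')$ there is a point $y\in Y\setminus\{\varphi(x),\varphi(x')\}$ such that $y\in\operatorname{im}(\varphi\circ\gamma)$ for every curve $\gamma:[0,1]\to X$ from $x$ to $x'$. Let $D(x,x')$ be the infimum of $\operatorname{diam}(\varphi(K))$ over all connected sets $K\subset X$ containing $x$ and $x'$. Let $T$ be the quotient of $X$ by the relation $x\sim x'\iff D(x,x')=0$, with the metric induced by $D$; this is the tree associated with $\varphi$. Equip $T$ with the monotone metric $$d_T(p,p')=\sup\{D(q,q') : q,q'\in[p,p']\},$$ where $[p,p']$ is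 the arc in $(T,D)$ from $p$ to $p'$ (the image of an injective curve from $p$ to $p'$, unique for $p\neq p'$; and $[p,p]=\{p\}$). Let $m\ge 2$, let $S^{m-1}$ and $B^m$ be the unit sphere and the closed unit ball of $\mathbb{R}^m$ with the Euclidean norm $|\cdot|$, let $L\ge 0$, and let $f:S^{m-1}\to T$ satisfy $d_T(f(s),f(s'))\le\sigma(L|s-s'|)$ for all $s,s'\in S^{m-1}$. Then there is a map $F:B^m\to T$ with $F|_{S^{m-1}}=f$ and $\operatorname{im}(F)=\operatorname{im}(f)$ such that $$d_T(F(x),F(x'))\le 2\,\sigma(2\pi L|x-x'|)\qquad\text{for all }x,x'\in B^m .$$ -/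

import Mathlib

open CategoryTheory CategoryTheory.Limits
open scoped NNReal ENNReal Simplicial

universe u v

/-- `X` is `C`-quasi-convex: any two points are joined by a curve of length at most `C` times
their distance. -/
def QuasiConvexSpace (C : ℝ≥0) (X : Type u) [MetricSpace X] : Prop :=
  ∀ x x' : X, ∃ γ : Path x x', eVariationOn γ Set.univ ≤ C * edist x x'

/-- `σ : [0,∞) → [0,∞)` is continuous, strictly increasing and vanishes at `0`. -/
structure IsModulus (σ : ℝ≥0 → ℝ≥0) : Prop where
  continuous : Continuous σ
  strictMono : StrictMono σ
  map_zero : σ 0 = 0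

/-- `φ` is `σ`-continuous: `d(φ x, φ x') ≤ σ(d(x, x'))`. -/
def SigmaContinuous {X : Type u} {Y : Type v} [MetricSpace X] [MetricSpace Y]
    (σ : ℝ≥0 → ℝ≥0) (φ : X → Y) : Prop :=
  ∀ x x' : X, nndist (φ x) (φ x') ≤ σ (nndist x x')

/-- Property (T): whenever `φ x ≠ φ x'`, there is a third point of `Y` that lies on the image under
`φ` of every curve from `x` to `x'`. -/
def PropertyT {X : Type u} {Y : Type v} [MetricSpace X] [MetricSpace Y] (φ : X → Y) : Prop :=
  ∀ x x' : X, φ x ≠ φ x' →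
    ∃ y : Y, y ≠ φ x ∧ y ≠ φ x' ∧ ∀ γ : Path x x', y ∈ Set.range (φ ∘ γ)

/-! ### Singular and singular Lipschitz homology with integer coefficients -/

/-- `H₁(X) = 0` for singular homology with integer coefficients. -/
def SingularH1Vanishes (X : Type u) [TopologicalSpace X] : Prop :=
  IsZero (((AlgebraicTopology.singularHomologyFunctor (ModuleCat.{u} ℤ) 1).obj
    (ModuleCat.of ℤ (ULift.{u} ℤ))).obj (TopCat.of X))

/-- An affine map between standard simplices that is induced by a map of the vertices is Lipschitz. -/
theorem exists_lipschitzWith_stdSimplex_map {m n : ℕ} (g : Fin m → Fin n) :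
    ∃ K : ℝ≥0, LipschitzWith K (stdSimplex.map (S := ℝ) g) := by
  let L : (Fin m → ℝ) →L[ℝ] (Fin n → ℝ) :=
    LinearMap.toContinuousLinearMap (FunOnFinite.linearMap ℝ ℝ g)
  refine ⟨‖L‖₊, fun s t => ?_⟩
  exact L.lipschitz s.1 t.1

/-- The simplicial set of singular Lipschitz simplices of a metric space, inside the simplicial
set of all singular simplices. -/
noncomputable def lipschitzSingularSubcomplex (X : Type u) [MetricSpace X] :
    (TopCat.toSSet.obj (TopCat.of X)).Subcomplex where
  obj n := {s | ∃ K : ℝ≥0, LipschitzWith K (TopCat.toSSetObjEquiv (TopCat.of X) n s)}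
  map := by
    rintro U V i s ⟨K, hK⟩
    obtain ⟨K', hK'⟩ := exists_lipschitzWith_stdSimplex_map i.unop
    exact ⟨K * K', hK.comp hK'⟩

/-- `H₁^Lip(X) = 0` for singular Lipschitz homology with integer coefficients. -/
def LipschitzH1Vanishes (X : Type u) [MetricSpace X] : Prop :=
  IsZero ((lipschitzSingularSubcomplex X : SSet.{u}).homology
    (ModuleCat.of ℤ (ULift.{u} ℤ)) 1)

/-! ### The tree of a map -/

/-- The domain `X` of `φ : X → Y`, to be endowed with the pseudo-metric `D`. -/
def TreeDomain {X : Type u} {Y : Type v} (_φ : X → Y) : Type u := X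

/-- `D(x,x')` is the infimum of the diameters of `φ(C)` over all connected sets `C ⊆ X`
containing `x` and `x'`. -/
noncomputable def treePseudoDist {X : Type u} {Y : Type v} [MetricSpace X] [MetricSpace Y]
    (φ : X → Y) (x x' : X) : ℝ≥0∞ :=
  ⨅ (C : Set X) (_ : IsConnected C) (_ : x ∈ C) (_ : x' ∈ C), Metric.ediam (φ '' C)

theorem treePseudoDist_self {X : Type u} {Y : Type v} [MetricSpace X] [MetricSpace Y]
    (φ : X → Y) (x : X) : treePseudoDist φ x x = 0 := by
  refine le_antisymm ?_ bot_le
  refine (iInf₂_le ({x} : Set X) isConnected_singleton).trans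
    ((iInf₂_le (Set.mem_singleton _) (Set.mem_singleton _)).trans ?_)
  simp

theorem treePseudoDist_comm {X : Type u} {Y : Type v} [MetricSpace X] [MetricSpace Y]
    (φ : X → Y) (x x' : X) : treePseudoDist φ x x' = treePseudoDist φ x' x := by
  refine iInf_congr fun C => iInf_congr fun _ => ?_
  rw [iInf_comm]

theorem treePseudoDist_triangle {X : Type u} {Y : Type v} [MetricSpace X] [MetricSpace Y]
    (φ : X → Y) (x x' x'' : X) :
    treePseudoDist φ x x'' ≤ treePseudoDist φ x x' + treePseudoDist φ x' x'' := by
  refine ENNReal.le_of_forall_pos_le_add fun ε hε hlt => ?_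
  obtain ⟨hA, hB⟩ := ENNReal.add_lt_top.1 hlt
  have hε2 : ((ε : ℝ≥0∞) / 2) ≠ 0 := by simp [hε.ne']
  have h1 := ENNReal.lt_add_right hA.ne hε2
  have h2 := ENNReal.lt_add_right hB.ne hε2
  conv_lhs at h1 => unfold treePseudoDist
  conv_lhs at h2 => unfold treePseudoDist
  simp only [iInf_lt_iff] at h1 h2
  obtain ⟨A, hAc, hxA, hx'A, hA'⟩ := h1
  obtain ⟨B, hBc, hx'B, hx''B, hB'⟩ := h2
  refine (iInf₂_le (A ∪ B) (IsConnected.union ⟨x', hx'A, hx'B⟩ hAc hBc)).trans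
    ((iInf₂_le (Or.inl hxA) (Or.inr hx''B)).trans ?_)
  rw [Set.image_union]
  refine (Metric.ediam_union_le ⟨φ x', Set.mem_image_of_mem _ hx'A,
    Set.mem_image_of_mem _ hx'B⟩).trans ?_
  refine (add_le_add hA'.le hB'.le).trans (le_of_eq ?_)
  rw [add_add_add_comm, ENNReal.add_halves]

noncomputable instance TreeDomain.instPseudoEMetricSpace {X : Type u} {Y : Type v}
    [MetricSpace X] [MetricSpace Y] (φ : X → Y) : PseudoEMetricSpace (TreeDomain φ) where
  edist x x' := treePseudoDist φ x x'
  edist_self := treePseudoDist_self φ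
  edist_comm := treePseudoDist_comm φ
  edist_triangle := treePseudoDist_triangle φ

/-- The tree `T = X/∼`, where `x ∼ x'` if and only if `D(x,x') = 0`. As a `SeparationQuotient` it
carries the metric induced by `D`, which is its `edist`. -/
abbrev FactorTree {X : Type u} {Y : Type v} [MetricSpace X] [MetricSpace Y] (φ : X → Y) : Type u :=
  SeparationQuotient (TreeDomain φ)

/-- `A` is an arc with endpoints `p` and `q`, i.e. the image of an injective curve from `p` to
`q`. -/
def IsArcBetween {T : Type u} [TopologicalSpace T] (p q : T) (A : Set T) : Prop :=
  ∃ γ : Path p q, Function.Injective γ ∧ Set.range γ = A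

/-- The monotone metric `d_T` on the tree: `d_T(p,p')` is the supremum of `D(q,q')` over all points
`q, q'` on the arc from `p` to `p'` (and `0` if `p = p'`). -/
noncomputable def treeDist {X : Type u} {Y : Type v} [MetricSpace X] [MetricSpace Y] (φ : X → Y)
    (p p' : FactorTree φ) : ℝ≥0∞ :=
  ⨆ (A : Set (FactorTree φ)) (_ : IsArcBetween p p' A) (q ∈ A) (q' ∈ A), edist q q'

/-! ### Cocycles and vanishing homology -/

/-! Two facts carry the proof: `T` really is a tree, and maps from spheres into a tree extend by
projecting to subtrees.

Tree structure. Property (T) gives a value `y` whose fibre meets every curve from `x` to `x'`, but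
this fibre may have many images in `T`. Choose by Zorn a minimal closed subset `G` of the fibre that
still separates `x` from `x'`. Since `H₁` vanishes, two disjoint closed sets that do not separate
`x` from `x'` have a union that does not either (`mem_connectedComponentIn_inter`); otherwise some
circle-valued function would have different total angles along two curves with the same endpoints.
Hence `G` cannot be split, so it lies in one component of the preimage of each ball about `y`, and
it becomes a single point of `T` (`PropertyT.exists_separating`). Every nondegenerate connected set
of `T` therefore contains two points separated by a third (`PropertyT.exists_cut_point`). It follows
that an injective curve lies in every closed connected set containing its endpoints, so its image is
`arcHull p q`, and `d_T(p,q)` is the diameter of this hull (`treeDist_eq_ediam`).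

Extension. Fix `a` on the sphere and let `A ρ` be the image under `f` of the cap of angular radius
`π ρ` about `a`. The point `r • s` goes to the projection of `f s` to the subtree `A ρ`, with `ρ =
max 0 (2r - 1)`. Distinct projections of two points to one subtree lie on the arc between these
points, which controls the angular direction. Projections of one point to nested subtrees lie on an
arc between the images of two points of the sphere at distance at most `π (ρ' - ρ)`, which controls
the radial direction. Each direction contributes one `σ (2πL|x - x'|)`. -/

theorem CategoryTheory.ShortComplex.Exact.comp_eq_zero_of_comp_eq_zero {𝒜 : Type*} [Category 𝒜]
    [Abelian 𝒜] {S : ShortComplex 𝒜} (hS : S.Exact) {R A : 𝒜} (z : R ⟶ S.X₂) (hz : z ≫ S.g = 0)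
    (k : S.X₂ ⟶ A) (hk : S.f ≫ k = 0) : z ≫ k = 0 := by
  have := hS.mono_fromOpcycles
  have hzp : z ≫ S.pOpcycles = 0 := by
    rw [← cancel_mono S.fromOpcycles, Category.assoc, S.p_fromOpcycles, zero_comp, hz]
  rw [← S.p_descOpcycles k hk, ← Category.assoc, hzp, zero_comp]

/-- If `H₁(S) = 0`, a `1`-cocycle takes the same value on edges with the same endpoints. -/
theorem SSet.cocycle_eq_of_isZero_homology_one (S : SSet.{u})
    (h : IsZero (S.homology (ModuleCat.of ℤ (ULift.{u} ℤ)) 1)) (c : S _⦋1⦌ → ℝ)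
    (hc : ∀ s : S _⦋2⦌, c (S.δ 0 s) - c (S.δ 1 s) + c (S.δ 2 s) = 0) (a b : S _⦋1⦌)
    (h0 : S.δ 0 a = S.δ 0 b) (h1 : S.δ 1 a = S.δ 1 b) : c a = c b := by
  let R := ModuleCat.of ℤ (ULift.{u} ℤ)
  let A := ModuleCat.of ℤ (ULift.{u} ℝ)
  -- The cocycle becomes a morphism on 1-chains that kills boundaries, hence by exactness also the
  -- cycle `a - b`.
  let m : ℝ → (R ⟶ A) := fun r => ModuleCat.ofHom
    ((LinearMap.toSpanSingleton ℤ (ULift.{u} ℝ) (ULift.up r)).comp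
      (ULift.moduleEquiv (R := ℤ) (M := ℤ)).toLinearMap)
  have hm (r : ℝ) : (m r).hom (ULift.up 1) = ULift.up r := by simp [m, R, A]
  have hm_ext (f : R ⟶ A) (h : f.hom (ULift.up 1) = ULift.up 0) : f = 0 := by
    ext x
    have : x = x.down • (ULift.up 1 : ULift.{u} ℤ) := by ext; simp
    rw [this, map_smul, h]
    exact smul_zero (A := ℝ) x.down
  let K := S.chainComplex R
  let g : K.X 1 ⟶ A := Sigma.desc fun s => m (c s)
  have hg (s : S _⦋1⦌) : S.ιChainComplex (R := R) s ≫ g = m (c s) := Sigma.ι_desc _ _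
  have hdg : K.d 2 1 ≫ g = 0 := by
    refine SSet.chainComplex_hom_ext fun s => ?_
    rw [SSet.ιChainComplex_d_assoc, comp_zero, Preadditive.sum_comp]
    simp only [Preadditive.zsmul_comp, hg]
    refine hm_ext _ ?_
    have h3 := Fin.sum_univ_three fun i : Fin 3 => (-1 : ℤ) ^ (i : ℕ) • m (c (S.δ i s))
    refine (congrArg (fun f : R ⟶ A => f.hom (ULift.up 1)) h3).trans (ULift.down_injective ?_)
    have := hc s
    simp [hm]
    change c _ + -c _ + c _ = 0
    linarith
  let z : R ⟶ K.X 1 := S.ιChainComplex a - S.ιChainComplex b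
  have hz : z ≫ K.d 1 0 = 0 := by
    simp only [z, Preadditive.sub_comp]
    rw [SSet.ιChainComplex_d, SSet.ιChainComplex_d]
    simp [Fin.sum_univ_two, h0, h1]
  have hex : (K.sc' 2 1 0).Exact := by
    rw [← HomologicalComplex.exactAt_iff' K 2 1 0 (by simp) (by simp),
      HomologicalComplex.exactAt_iff_isZero_homology]
    exact h
  have hzg : z ≫ g = 0 := hex.comp_eq_zero_of_comp_eq_zero z hz g hdg
  simp only [z, Preadditive.sub_comp, hg] at hzg
  have := congrArg (fun f : R ⟶ A => f.hom (ULift.up 1)) hzg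
  simp [hm, sub_eq_zero] at this
  exact congrArg ULift.down this

/-- A map from a standard simplex to the circle lifts to the real line. -/
theorem stdSimplex.exists_lift_addCircle {n : ℕ}
    (g : C(stdSimplex ℝ (Fin (n + 1)), AddCircle (1 : ℝ))) :
    ∃ l : C(stdSimplex ℝ (Fin (n + 1)), ℝ), ∀ t, (l t : AddCircle (1 : ℝ)) = g t := by
  have cov : IsCoveringMap ((↑) : ℝ → AddCircle (1 : ℝ)) := AddCircle.isCoveringMap_coe 1
  let b : stdSimplex ℝ (Fin (n + 1)) := stdSimplex.vertex 0
  have hmem (p : unitInterval × stdSimplex ℝ (Fin (n + 1))) :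
      (1 - (p.1 : ℝ)) • b.1 + (p.1 : ℝ) • p.2.1 ∈ stdSimplex ℝ (Fin (n + 1)) :=
    convex_stdSimplex ℝ _ b.2 p.2.2 (by linarith [p.1.2.2]) p.1.2.1 (by ring)
  -- The straight-line contraction to a vertex; lifting it from a constant start lifts `g` at time
  -- `1`.
  let κ : C(unitInterval × stdSimplex ℝ (Fin (n + 1)), stdSimplex ℝ (Fin (n + 1))) :=
    ⟨fun p => ⟨_, hmem p⟩, by
      refine Continuous.subtype_mk ?_ _
      fun_prop⟩
  obtain ⟨e, he⟩ := QuotientAddGroup.mk_surjective (g b)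
  have hκ0 (t) : κ (0, t) = b := by ext; simp [κ]
  have hκ1 (t) : κ (1, t) = t := by ext; simp [κ]
  have H0 (a : stdSimplex ℝ (Fin (n + 1))) :
      (g.comp κ) (0, a) = ((ContinuousMap.const _ e : C(stdSimplex ℝ (Fin (n + 1)), ℝ)) a :
        AddCircle (1 : ℝ)) := by
    simp only [ContinuousMap.comp_apply, hκ0, ContinuousMap.const_apply]
    exact he.symm
  refine ⟨(cov.liftHomotopy (g.comp κ) (ContinuousMap.const _ e) H0).comp
    ⟨fun t => (1, t), by fun_prop⟩, fun t => ?_⟩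
  have := congrFun (cov.liftHomotopy_lifts (g.comp κ) (ContinuousMap.const _ e) H0) (1, t)
  simpa [hκ1] using this

/-- Two lifts differ by a constant on a connected domain, so increments of a lift depend only on the
circle-valued map. -/
theorem AddCircle.sub_eq_sub_of_lift {K : Type*} [TopologicalSpace K] [PreconnectedSpace K]
    (l l' : C(K, ℝ)) (h : ∀ t, (l t : AddCircle (1 : ℝ)) = l' t) (s t : K) :
    l s - l t = l' s - l' t := by
  have cov : IsCoveringMap ((↑) : ℝ → AddCircle (1 : ℝ)) := AddCircle.isCoveringMap_coe 1
  have := cov.eq_of_comp_eq (g₁ := l) (g₂ := fun x => l' x + (l t - l' t)) l.continuous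
    (by fun_prop) (by
      funext x
      have := h t
      simp only [Function.comp_apply, QuotientAddGroup.mk_add, QuotientAddGroup.mk_sub]
      rw [h x, this]; simp) t (by simp)
  have := congrFun this s
  linarith

theorem symm_mem_lipschitzSingularSubcomplex {X : Type u} [MetricSpace X]
    (g : C(stdSimplex ℝ (Fin 2), X)) (hg : ∃ K, LipschitzWith K g) :
    (TopCat.toSSetObjEquiv (TopCat.of X) (Opposite.op ⦋1⦌)).symm g ∈
      (lipschitzSingularSubcomplex X).obj (Opposite.op ⦋1⦌) := by
  obtain ⟨K, hK⟩ := hg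
  refine ⟨K, ?_⟩
  rw [Equiv.apply_symm_apply]
  exact hK

/-- If the singular or singular Lipschitz `H₁(X)` vanishes, the total angle of a circle-valued
function along a Lipschitz curve only depends on the endpoints. -/
theorem lift_sub_eq_of_H1Vanishes {X : Type u} [MetricSpace X]
    (hH : SingularH1Vanishes X ∨ LipschitzH1Vanishes X) (Θ : C(X, AddCircle (1 : ℝ)))
    (a b : C(stdSimplex ℝ (Fin 2), X)) (ha : ∃ K, LipschitzWith K a) (hb : ∃ K, LipschitzWith K b)
    (h0 : a (stdSimplex.vertex 0) = b (stdSimplex.vertex 0))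
    (h1 : a (stdSimplex.vertex 1) = b (stdSimplex.vertex 1))
    (la lb : C(stdSimplex ℝ (Fin 2), ℝ)) (hla : ∀ t, (la t : AddCircle (1 : ℝ)) = Θ (a t))
    (hlb : ∀ t, (lb t : AddCircle (1 : ℝ)) = Θ (b t)) :
    la (stdSimplex.vertex 1) - la (stdSimplex.vertex 0) =
      lb (stdSimplex.vertex 1) - lb (stdSimplex.vertex 0) := by
  have _ : PathConnectedSpace (stdSimplex ℝ (Fin 2)) := inferInstance
  choose lift hlift using fun g : C(stdSimplex ℝ (Fin 2), X) =>
    stdSimplex.exists_lift_addCircle (Θ.comp g)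
  let w : C(stdSimplex ℝ (Fin 2), X) → ℝ := fun g =>
    lift g (stdSimplex.vertex 1) - lift g (stdSimplex.vertex 0)
  have hw (g : C(stdSimplex ℝ (Fin 2), X)) (l : C(stdSimplex ℝ (Fin 2), ℝ))
      (hl : ∀ t, (l t : AddCircle (1 : ℝ)) = Θ (g t)) :
      w g = l (stdSimplex.vertex 1) - l (stdSimplex.vertex 0) :=
    AddCircle.sub_eq_sub_of_lift _ _ (fun t => (hlift g t).trans (hl t).symm) _ _
  rw [← hw a la hla, ← hw b lb hlb]
  let E := TopCat.toSSetObjEquiv (TopCat.of X)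
  let S := TopCat.toSSet.obj (TopCat.of X)
  let c : S _⦋1⦌ → ℝ := fun s => w (E _ s)
  have hδ (n : ℕ) (i : Fin (n + 2)) (s : S _⦋n + 1⦌) (t) :
      (E _ (S.δ i s)) t = (E _ s) (stdSimplex.map (SimplexCategory.δ i) t) := rfl
  -- The total angle is a cocycle: one lift over the whole triangle computes all three edges, and
  -- the increments telescope.
  have hcoc (s : S _⦋2⦌) : c (S.δ 0 s) - c (S.δ 1 s) + c (S.δ 2 s) = 0 := by
    obtain ⟨l, hl⟩ := stdSimplex.exists_lift_addCircle (Θ.comp (E _ s))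
    have key (i : Fin 3) : c (S.δ i s) = l (stdSimplex.vertex (i.succAbove 1)) -
        l (stdSimplex.vertex (i.succAbove 0)) := by
      have := hw (E _ (S.δ i s)) (l.comp ⟨stdSimplex.map (SimplexCategory.δ i),
        stdSimplex.continuous_map _⟩) (fun t => hl _)
      simp only [c, this, ContinuousMap.comp_apply, ContinuousMap.coe_mk, stdSimplex.map_vertex]
      rfl
    rw [key, key, key]
    have e1 : (0 : Fin 3).succAbove 1 = 2 := rfl
    have e2 : (0 : Fin 3).succAbove 0 = 1 := rfl
    have e3 : (1 : Fin 3).succAbove 1 = 2 := rfl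
    have e4 : (1 : Fin 3).succAbove 0 = 0 := rfl
    have e5 : (2 : Fin 3).succAbove 1 = 1 := rfl
    have e6 : (2 : Fin 3).succAbove 0 = 0 := rfl
    simp only [e1, e2, e3, e4, e5, e6]
    ring
  have hface (a b : S _⦋1⦌) (i : Fin 2)
      (h : E _ a (stdSimplex.vertex (i.succAbove 0)) = E _ b (stdSimplex.vertex (i.succAbove 0))) :
      S.δ i a = S.δ i b := by
    apply (E _).injective
    ext t
    have ht : t = stdSimplex.vertex (0 : Fin 1) := by
      change stdSimplex ℝ (Fin 1) at t
      exact Subsingleton.elim _ _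
    rw [hδ, hδ, ht, stdSimplex.map_vertex]
    exact h
  rcases hH with h | h
  · have := S.cocycle_eq_of_isZero_homology_one h c hcoc ((E _).symm a) ((E _).symm b)
      (hface _ _ 0 (by simpa using h1)) (hface _ _ 1 (by simpa using h0))
    simpa [c] using this
  · let S' := lipschitzSingularSubcomplex X
    have := SSet.cocycle_eq_of_isZero_homology_one (S' : SSet.{u}) h (fun s => c s.1)
      (fun s => hcoc s.1)
      ⟨(E _).symm a, symm_mem_lipschitzSingularSubcomplex a ha⟩
      ⟨(E _).symm b, symm_mem_lipschitzSingularSubcomplex b hb⟩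
      (Subtype.ext (hface _ _ 0 (by simpa using h1))) (Subtype.ext (hface _ _ 1 (by simpa using h0)))
    simpa [c] using this
/-! ### Lipschitz curves in quasi-convex spaces -/

/-- `x` and `x'` are joined by a rectifiable curve in `U`. -/
def JoinedByLipschitz {X : Type u} [MetricSpace X] (U : Set X) (x x' : X) : Prop :=
  ∃ (c : ℝ → X) (l : ℝ), 0 ≤ l ∧ LipschitzWith 1 c ∧ c 0 = x ∧ c l = x' ∧ ∀ t, c t ∈ U

theorem JoinedByLipschitz.symm {X : Type u} [MetricSpace X] {U : Set X} {x x' : X}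
    (h : JoinedByLipschitz U x x') : JoinedByLipschitz U x' x := by
  obtain ⟨c, l, hl, hc, h0, h1, hU⟩ := h
  refine ⟨fun t => c (l - t), l, hl, ?_, by simpa, by simpa, fun t => hU _⟩
  refine LipschitzWith.of_dist_le_mul fun s t => (hc.dist_le_mul _ _).trans_eq ?_
  rw [dist_sub_left]

theorem JoinedByLipschitz.trans {X : Type u} [MetricSpace X] {U : Set X} {x x' x'' : X}
    (h : JoinedByLipschitz U x x') (h' : JoinedByLipschitz U x' x'') :
    JoinedByLipschitz U x x'' := by
  obtain ⟨c, l, hl, hc, h0, h1, hU⟩ := h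
  obtain ⟨c', l', hl', hc', h0', h1', hU'⟩ := h'
  have key (s t : ℝ) (hst : s ≤ t) :
      dist (if s ≤ l then c s else c' (s - l)) (if t ≤ l then c t else c' (t - l)) ≤ t - s := by
    split_ifs with hs ht ht
    · simpa [Real.dist_eq, abs_sub_comm s t, abs_of_nonneg (sub_nonneg.2 hst)]
        using hc.dist_le_mul s t
    · push Not at ht
      have e1 := hc.dist_le_mul s l
      have e2 := hc'.dist_le_mul 0 (t - l)
      rw [Real.dist_eq, abs_of_nonpos (by linarith)] at e1 e2
      rw [h1] at e1
      rw [h0'] at e2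
      have := dist_triangle (c s) x' (c' (t - l))
      simp at e1 e2
      linarith
    · linarith
    · have e := hc'.dist_le_mul (s - l) (t - l)
      rw [Real.dist_eq, abs_of_nonpos (by linarith)] at e
      simp at e
      linarith
  refine ⟨fun t => if t ≤ l then c t else c' (t - l), l + l', by linarith, ?_, by simp [hl, h0],
    ?_, fun t => ?_⟩
  · refine LipschitzWith.of_dist_le_mul fun s t => ?_
    rcases le_total s t with h | h
    · simpa [Real.dist_eq, abs_sub_comm s t, abs_of_nonneg (sub_nonneg.2 h)] using key s t h
    · simpa [Real.dist_eq, abs_of_nonneg (sub_nonneg.2 h), dist_comm] using key t s h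
  · rcases hl'.eq_or_lt with rfl | h
    · simp [h1, ← h1', h0']
    · simp [h, h1']
  · dsimp only
    split_ifs
    exacts [hU _, hU' _]

theorem JoinedByLipschitz.mono {X : Type u} [MetricSpace X] {U V : Set X} (hUV : U ⊆ V) {x x' : X}
    (h : JoinedByLipschitz U x x') : JoinedByLipschitz V x x' := by
  obtain ⟨c, l, hl, hc, h0, h1, hU⟩ := h
  exact ⟨c, l, hl, hc, h0, h1, fun t => hUV (hU t)⟩

theorem JoinedByLipschitz.left_mem {X : Type u} [MetricSpace X] {U : Set X} {x x' : X}
    (h : JoinedByLipschitz U x x') : x ∈ U := by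
  obtain ⟨c, l, hl, hc, h0, h1, hU⟩ := h
  exact h0 ▸ hU 0

theorem JoinedByLipschitz.mem_connectedComponentIn {X : Type u} [MetricSpace X] {U : Set X}
    {x x' : X} (h : JoinedByLipschitz U x x') : x' ∈ connectedComponentIn U x := by
  obtain ⟨c, l, hl, hc, h0, h1, hU⟩ := h
  exact (isPreconnected_range hc.continuous).subset_connectedComponentIn ⟨0, h0⟩
    (Set.range_subset_iff.2 hU) ⟨l, h1⟩

/-- Length bounds at a time defined as a supremum are available only strictly before or after it;
continuity carries them to the endpoints. -/
theorem edist_le_of_forall_Ioo {X : Type u} [MetricSpace X] {γ : ℝ → X} (hγ : Continuous γ)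
    {a b : ℝ} (hab : a < b) {r : ℝ≥0∞}
    (h : ∀ s t, a < s → s ≤ t → t < b → edist (γ s) (γ t) ≤ r) : edist (γ a) (γ b) ≤ r := by
  let P : Set (ℝ × ℝ) := Set.ofPred fun p => edist (γ p.1) (γ p.2) ≤ r
  have hcl : IsClosed P :=
    isClosed_le (by fun_prop) continuous_const
  have hsub : Set.Ioo a b ×ˢ Set.Ioo a b ⊆ P := by
    rintro ⟨s, t⟩ ⟨hs, ht⟩
    rcases le_total s t with hst | hst
    · exact h s t hs.1 hst ht.2
    · exact (edist_comm _ _).trans_le (h t s ht.1 hst hs.2)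
  have := closure_minimal hsub hcl
  rw [closure_prod_eq, closure_Ioo hab.ne] at this
  exact this (Set.mk_mem_prod (Set.left_mem_Icc.2 hab.le) (Set.right_mem_Icc.2 hab.le))

/-- The curve is reparametrized by arc length: `τ u` is the supremum of the times up to which the
length is at most `u`. Where the curve rests `τ` jumps, but `g ∘ τ` does not, because the length
gained between `τ u` and `τ v` is at most `v - u`. -/
theorem QuasiConvexSpace.joinedByLipschitz {X : Type u} [MetricSpace X] {C : ℝ≥0}
    (hX : QuasiConvexSpace C X) (x x' : X) :
    JoinedByLipschitz {y | edist x y ≤ C * edist x x'} x x' := by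
  obtain ⟨γ, hγ⟩ := hX x x'
  let g : ℝ → X := γ.extend
  have hg : Continuous g := γ.continuous_extend
  let V : ℝ → ℝ≥0∞ := fun t => eVariationOn g (Set.Icc 0 t)
  have hVmono : Monotone V := fun s t hst => eVariationOn.mono _ (Set.Icc_subset_Icc_right hst)
  have hV1 : V 1 ≤ C * edist x x' := by
    refine le_trans ?_ hγ
    exact eVariationOn.comp_le_of_monotoneOn γ (Set.projIcc 0 1 zero_le_one)
      ((Set.monotone_projIcc _).monotoneOn _) (Set.mapsTo_univ _ _)
  have hV1' : V 1 ≠ ∞ := ne_top_of_le_ne_top (ENNReal.mul_ne_top (by simp) (edist_ne_top _ _)) hV1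
  have hadd {s t : ℝ} (hs : 0 ≤ s) (hst : s ≤ t) : V s + edist (g s) (g t) ≤ V t := by
    have := eVariationOn.Icc_add_Icc g (s := Set.univ) hs hst (Set.mem_univ _)
    simp only [Set.univ_inter] at this
    rw [show V t = _ from this.symm]
    gcongr
    exact eVariationOn.edist_le _ (Set.left_mem_Icc.2 hst) (Set.right_mem_Icc.2 hst)
  have hg0 : g 0 = x := γ.extend_zero
  have hg1 : g 1 = x' := γ.extend_one
  let S : ℝ → Set ℝ := fun u => {t | t ∈ Set.Icc (0 : ℝ) 1 ∧ V t ≤ ENNReal.ofReal u}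
  have hS0 (u : ℝ) : (0 : ℝ) ∈ S u := ⟨by simp, by simp [V]⟩
  have hSb (u : ℝ) : BddAbove (S u) := ⟨1, fun t ht => ht.1.2⟩
  let τ : ℝ → ℝ := fun u => sSup (S u)
  have hτ0 (u : ℝ) : 0 ≤ τ u := le_csSup (hSb u) (hS0 u)
  have hτ1 (u : ℝ) : τ u ≤ 1 := csSup_le ⟨0, hS0 u⟩ fun t ht => ht.1.2
  have hτmono : Monotone τ := fun u v huv => csSup_le_csSup (hSb v) ⟨0, hS0 u⟩
    fun t ht => ⟨ht.1, ht.2.trans (ENNReal.ofReal_le_ofReal huv)⟩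
  have hlt {u t : ℝ} (ht : t < τ u) : V t ≤ ENNReal.ofReal u := by
    obtain ⟨s, hs, hts⟩ := exists_lt_of_lt_csSup ⟨0, hS0 u⟩ ht
    exact (hVmono hts.le).trans hs.2
  have hgt {u t : ℝ} (ht : τ u < t) (ht1 : t ≤ 1) : ENNReal.ofReal u < V t := by
    by_contra! h
    exact ht.not_ge (le_csSup (hSb u) ⟨⟨(hτ0 u).trans ht.le, ht1⟩, h⟩)
  have hlip (u v : ℝ) (huv : u ≤ v) : edist (g (τ u)) (g (τ v)) ≤ ENNReal.ofReal (v - u) := by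
    rcases (hτmono huv).eq_or_lt with h | h
    · simp [h]
    · refine edist_le_of_forall_Ioo hg h fun s t hs hst ht => ?_
      have h1 := hadd ((hτ0 u).trans hs.le) hst
      have h2 := hlt ht
      have h3 := hgt hs ((hst.trans ht.le).trans (hτ1 v))
      have h4 : ENNReal.ofReal u + edist (g s) (g t) ≤ ENNReal.ofReal v :=
        (add_le_add_left h3.le _).trans (h1.trans h2)
      have h5 : ENNReal.ofReal v ≤ ENNReal.ofReal u + ENNReal.ofReal (v - u) := by
        refine le_trans (le_of_eq ?_) ENNReal.ofReal_add_le
        congr 1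
        ring
      exact (ENNReal.add_le_add_iff_left ENNReal.ofReal_ne_top).1 (h4.trans h5)
  refine ⟨fun u => g (τ u), (V 1).toReal, ENNReal.toReal_nonneg, ?_, ?_, ?_, fun u => ?_⟩
  · intro u v
    rw [edist_dist u v, Real.dist_eq, ENNReal.coe_one, one_mul]
    rcases le_total u v with h | h
    · rw [abs_sub_comm, abs_of_nonneg (sub_nonneg.2 h)]
      exact hlip u v h
    · rw [abs_of_nonneg (sub_nonneg.2 h), edist_comm]
      exact hlip v u h
  -- The curve may rest at `x` for a while, so `τ 0` can be positive.
  · rcases (hτ0 0).eq_or_lt with h | h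
    · simp [← h, hg0]
    · have := edist_le_of_forall_Ioo hg h (r := 0) fun s t hs hst ht => by
        have h1 := hadd hs.le hst
        have h2 := hlt ht
        simp only [ENNReal.ofReal_zero] at h2
        exact le_add_self.trans (h1.trans h2)
      rw [nonpos_iff_eq_zero, edist_eq_zero] at this
      exact this.symm.trans hg0
  · have : τ (V 1).toReal = 1 := le_antisymm (hτ1 _)
      (le_csSup (hSb _) ⟨by simp, by rw [ENNReal.ofReal_toReal hV1']⟩)
    simp [this, hg1]
  · have := eVariationOn.edist_le g (s := Set.Icc 0 1) (x := 0) (y := τ u) (by simp)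
      ⟨hτ0 u, hτ1 u⟩
    rw [hg0] at this
    exact this.trans hV1

/-! ### Components of open sets and rectifiable curves -/

theorem QuasiConvexSpace.eventually_joinedByLipschitz {X : Type u} [MetricSpace X] {C : ℝ≥0}
    (hX : QuasiConvexSpace C X) {U : Set X} (hU : IsOpen U) {x : X} (hx : x ∈ U) :
    ∃ r > 0, ∀ y, edist x y < r → JoinedByLipschitz U x y := by
  obtain ⟨ε, hε, hεU⟩ := EMetric.isOpen_iff.1 hU x hx
  refine ⟨ε / (C + 1), by simp [hε.ne', ENNReal.div_pos_iff], fun y hy =>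
    (hX.joinedByLipschitz x y).mono fun z hz => hεU ?_⟩
  rw [Metric.mem_eball, edist_comm]
  refine lt_of_le_of_lt hz ?_
  have h1 : edist x y * (C + 1) < ε := (ENNReal.lt_div_iff_mul_lt (by simp) (by simp)).1 hy
  refine lt_of_le_of_lt ?_ h1
  rw [mul_comm]
  gcongr
  exact le_self_add

/-- Points of `U` that can be reached from `x` and points that cannot form two disjoint open sets,
by quasi-convexity at small scales. -/
theorem QuasiConvexSpace.joinedByLipschitz_of_mem_connectedComponentIn {X : Type u} [MetricSpace X]
    {C : ℝ≥0} (hX : QuasiConvexSpace C X) {U : Set X} (hU : IsOpen U) {x x' : X}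
    (h : x' ∈ connectedComponentIn U x) : JoinedByLipschitz U x x' := by
  have hxU : x ∈ U := by
    by_contra hx
    simp [connectedComponentIn_eq_empty hx] at h
  let A := {y | JoinedByLipschitz U x y}
  let B := {y | y ∈ U ∧ ¬ JoinedByLipschitz U x y}
  have hA : IsOpen A := by
    refine EMetric.isOpen_iff.2 fun y hy => ?_
    obtain ⟨r, hr, hry⟩ := hX.eventually_joinedByLipschitz hU (JoinedByLipschitz.symm hy).left_mem
    refine ⟨r, hr, fun z hz => JoinedByLipschitz.trans hy (hry z ?_)⟩
    rwa [edist_comm]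
  have hB : IsOpen B := by
    refine EMetric.isOpen_iff.2 fun y hy => ?_
    obtain ⟨r, hr, hry⟩ := hX.eventually_joinedByLipschitz hU hy.1
    have hz' (z) (hz : z ∈ Metric.eball y r) : JoinedByLipschitz U y z := hry z (by
      rwa [edist_comm])
    exact ⟨r, hr, fun z hz => ⟨(hz' z hz).symm.left_mem, fun hxz =>
      hy.2 (hxz.trans (hz' z hz).symm)⟩⟩
  have hxA : x ∈ A := by
    obtain ⟨r, hr, hrx⟩ := hX.eventually_joinedByLipschitz hU hxU
    exact hrx x (by simpa)
  refine (isPreconnected_connectedComponentIn (x := x) (F := U)).subset_left_of_subset_union hA hB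
    ?_ ?_ ⟨x, mem_connectedComponentIn hxU, hxA⟩ h
  · exact Set.disjoint_left.2 fun y hy hy' => hy'.2 hy
  · intro y hy
    by_cases hyA : JoinedByLipschitz U x y
    exacts [Or.inl hyA, Or.inr ⟨connectedComponentIn_subset _ _ hy, hyA⟩]

theorem QuasiConvexSpace.isOpen_connectedComponentIn {X : Type u} [MetricSpace X]
    {C : ℝ≥0} (hX : QuasiConvexSpace C X) {U : Set X} (hU : IsOpen U) (x : X) :
    IsOpen (connectedComponentIn U x) := by
  refine EMetric.isOpen_iff.2 fun y hy => ?_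
  obtain ⟨r, hr, hry⟩ := hX.eventually_joinedByLipschitz hU (connectedComponentIn_subset _ _ hy)
  refine ⟨r, hr, fun z hz => ?_⟩
  rw [connectedComponentIn_eq hy]
  exact (hry z (by rwa [edist_comm])).mem_connectedComponentIn
/-! ### Unions of non-separating closed sets do not separate -/

theorem QuasiConvexSpace.isOpen_diff_connectedComponentIn {X : Type u} [MetricSpace X]
    {C : ℝ≥0} (hX : QuasiConvexSpace C X) {U : Set X} (hU : IsOpen U) (x : X) :
    IsOpen (U \ connectedComponentIn U x) := by
  refine isOpen_iff_forall_mem_open.2 fun y hy => ⟨connectedComponentIn U y, fun z hz =>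
    ⟨connectedComponentIn_subset _ _ hz, fun hzx => hy.2 ?_⟩, hX.isOpen_connectedComponentIn hU y,
    mem_connectedComponentIn hy.1⟩
  rw [connectedComponentIn_eq hzx, ← connectedComponentIn_eq hz]
  exact mem_connectedComponentIn hy.1

/-- Inside `U`, the boundary of `W` lies outside `V`, where `μ` vanishes, so cutting off at `W`
creates no jump. -/
theorem continuousOn_indicator_of_isOpen {X : Type u} [TopologicalSpace X] {U V W : Set X}
    (hW : IsOpen W) (hW' : IsOpen ((U ∩ V) \ W)) (hWV : W ⊆ V)
    {μ : X → ℝ} (hμ : Continuous μ) (h0 : ∀ z, 0 ≤ μ z) (hμV : ∀ z ∉ V, μ z = 0) :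
    ContinuousOn (W.indicator μ) U := by
  refine fun z hzU => ContinuousAt.continuousWithinAt ?_
  by_cases hzV : z ∈ V
  · by_cases hzW : z ∈ W
    · refine hμ.continuousAt.congr ?_
      filter_upwards [hW.mem_nhds hzW] with w hw
      simp [hw]
    · refine (continuousAt_const (y := (0 : ℝ))).congr ?_
      filter_upwards [hW'.mem_nhds ⟨⟨hzU, hzV⟩, hzW⟩] with w hw
      simp [hw.2]
  · have hzW : z ∉ W := fun h => hzV (hWV h)
    rw [ContinuousAt, Set.indicator_of_notMem hzW]
    refine squeeze_zero (fun w => Set.indicator_nonneg (fun z _ => h0 z) w)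
      (fun w => Set.indicator_le_self' (fun _ _ => h0 _) w) ?_
    simpa [hμV z hzV] using hμ.tendsto z

theorem JoinedByLipschitz.exists_simplex {X : Type u} [MetricSpace X] {U : Set X} {x x' : X}
    (h : JoinedByLipschitz U x x') :
    ∃ a : C(stdSimplex ℝ (Fin 2), X), (∃ K, LipschitzWith K a) ∧ a (stdSimplex.vertex 0) = x ∧
      a (stdSimplex.vertex 1) = x' ∧ ∀ t, a t ∈ U := by
  obtain ⟨c, l, hl, hc, h0, h1, hU⟩ := h
  have hlip : LipschitzWith (1 * (l.toNNReal * 1))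
      (fun t : stdSimplex ℝ (Fin 2) => c (l * t.1 1)) := by
    refine hc.comp (LipschitzWith.comp (g := fun t : stdSimplex ℝ (Fin 2) => t.1 1)
      (f := fun s : ℝ => l * s) ?_ ?_)
    · refine LipschitzWith.of_dist_le_mul fun s t => ?_
      rw [Real.dist_eq, ← mul_sub, abs_mul, abs_of_nonneg hl, Real.coe_toNNReal _ hl, Real.dist_eq]
    · exact LipschitzWith.of_dist_le_mul fun s t => by
        rw [NNReal.coe_one, one_mul, Subtype.dist_eq]
        exact dist_le_pi_dist s.1 t.1 1
  exact ⟨⟨_, hlip.continuous⟩, ⟨_, hlip⟩, by simpa using h0, by simpa using h1, fun t => hU _⟩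

/-- A Janiszewski type theorem: if neither `Uᶜ` nor `Vᶜ` separates `x` from `x'`, and these closed
sets are disjoint, then their union does not separate `x` from `x'`. -/
theorem mem_connectedComponentIn_inter {X : Type u} [MetricSpace X] {C : ℝ≥0}
    (hX : QuasiConvexSpace C X) (hH : SingularH1Vanishes X ∨ LipschitzH1Vanishes X)
    {U V : Set X} (hU : IsOpen U) (hV : IsOpen V) (hUV : U ∪ V = Set.univ) {x x' : X}
    (hxU : x' ∈ connectedComponentIn U x) (hxV : x' ∈ connectedComponentIn V x) :
    x' ∈ connectedComponentIn (U ∩ V) x := by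
  by_contra hx'W
  set W := connectedComponentIn (U ∩ V) x with hWdef
  have hJU := hX.joinedByLipschitz_of_mem_connectedComponentIn hU hxU
  have hJV := hX.joinedByLipschitz_of_mem_connectedComponentIn hV hxV
  have hxW : x ∈ W := mem_connectedComponentIn ⟨hJU.left_mem, hJV.left_mem⟩
  have hWo : IsOpen W := hX.isOpen_connectedComponentIn (hU.inter hV) x
  have hW'o : IsOpen ((U ∩ V) \ W) := hX.isOpen_diff_connectedComponentIn (hU.inter hV) x
  have hWsub : W ⊆ U ∩ V := connectedComponentIn_subset _ _
  obtain ⟨lam, hl0, hl1, hl01⟩ := exists_continuous_zero_one_of_isClosed hV.isClosed_compl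
    hU.isClosed_compl (by
      rw [Set.disjoint_left]
      intro z hz hz'
      have : z ∈ U ∪ V := hUV ▸ Set.mem_univ z
      exact this.elim hz' hz)
  -- Both functions equal `lam` on `W`; off `W` they are `0` and `1`. They define the same
  -- circle-valued map, `h0` lifting it continuously over `U` and `h1` over `V`. From `x` to `x'`
  -- the angle changes by `-lam x` in `U` but by `1 - lam x` in `V`.
  let h0 : X → ℝ := W.indicator lam
  let h1 : X → ℝ := fun z => 1 - W.indicator (fun z => 1 - lam z) z
  have hc0 : ContinuousOn h0 U := continuousOn_indicator_of_isOpen hWo hW'o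
    (hWsub.trans Set.inter_subset_right) lam.continuous (fun z => (hl01 z).1) hl0
  have hc1 : ContinuousOn h1 V := continuousOn_const.sub <|
    continuousOn_indicator_of_isOpen hWo (by rwa [Set.inter_comm])
    (hWsub.trans Set.inter_subset_left) (by fun_prop) (fun z => by linarith [(hl01 z).2])
    (fun z hz => by simp [hl1 hz])
  have h01 (z : X) : (h1 z : AddCircle (1 : ℝ)) = h0 z := by
    by_cases hz : z ∈ W
    · simp [h0, h1, hz]
    · simp [h0, h1, hz]
  have hΘ : Continuous fun z => (h0 z : AddCircle (1 : ℝ)) := by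
    refine continuous_iff_continuousAt.2 fun z => ?_
    have hz : z ∈ U ∪ V := hUV ▸ Set.mem_univ z
    rcases hz with hz | hz
    · exact (AddCircle.continuous_mk' 1).continuousAt.comp (hc0.continuousAt (hU.mem_nhds hz))
    · simp_rw [← h01]
      exact (AddCircle.continuous_mk' 1).continuousAt.comp (hc1.continuousAt (hV.mem_nhds hz))
  obtain ⟨a, hal, ha0, ha1, haU⟩ := hJU.exists_simplex
  obtain ⟨b, hbl, hb0, hb1, hbV⟩ := hJV.exists_simplex
  have := lift_sub_eq_of_H1Vanishes hH ⟨_, hΘ⟩ a b hal hbl (ha0.trans hb0.symm) (ha1.trans hb1.symm)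
    ⟨h0 ∘ a, hc0.comp_continuous a.continuous haU⟩ ⟨h1 ∘ b, hc1.comp_continuous b.continuous hbV⟩
    (fun t => rfl) (fun t => h01 _)
  simp [ha0, ha1, hb0, hb1, h0, h1, hxW, hx'W] at this
  linarith
/-! ### Separating fibres -/

theorem SigmaContinuous.continuous {X : Type u} {Y : Type v} [MetricSpace X] [MetricSpace Y]
    {σ : ℝ≥0 → ℝ≥0} (hσ : IsModulus σ) {φ : X → Y} (hφ : SigmaContinuous σ φ) : Continuous φ := by
  refine continuous_iff_continuousAt.2 fun x => tendsto_iff_edist_tendsto_0.2 ?_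
  have h : Filter.Tendsto (fun y => ((σ (nndist y x) : ℝ≥0) : ℝ≥0∞)) (nhds x) (nhds 0) := by
    rw [← ENNReal.coe_zero, ENNReal.tendsto_coe, ← hσ.map_zero, ← nndist_self x]
    exact (hσ.continuous.comp (continuous_id.nndist continuous_const)).tendsto x
  refine tendsto_of_tendsto_of_tendsto_of_le_of_le tendsto_const_nhds h (fun y => bot_le)
    fun y => ?_
  simp only [edist_nndist]
  exact_mod_cast hφ y x

theorem treePseudoDist_le_of_subset {X : Type u} {Y : Type v} [MetricSpace X] [MetricSpace Y]
    {φ : X → Y} {K : Set X} (hK : IsPreconnected K) {x x' : X} (hx : x ∈ K) (hx' : x' ∈ K) :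
    treePseudoDist φ x x' ≤ Metric.ediam (φ '' K) :=
  (iInf₂_le K ⟨⟨x, hx⟩, hK⟩).trans (iInf₂_le hx hx')

theorem treePseudoDist_le_two_mul {X : Type u} {Y : Type v} [MetricSpace X] [MetricSpace Y]
    {φ : X → Y} {K : Set X} (hK : IsPreconnected K) {x x' : X} (hx : x ∈ K) (hx' : x' ∈ K)
    {y : Y} {r : ℝ≥0∞} (h : ∀ k ∈ K, edist (φ k) y ≤ r) : treePseudoDist φ x x' ≤ 2 * r := by
  refine (treePseudoDist_le_of_subset hK hx hx').trans (Metric.ediam_le ?_)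
  rintro _ ⟨k, hk, rfl⟩ _ ⟨k', hk', rfl⟩
  rw [two_mul]
  exact (edist_triangle_right _ _ y).trans (add_le_add (h k hk) (h k' hk'))

theorem edist_le_treePseudoDist {X : Type u} {Y : Type v} [MetricSpace X] [MetricSpace Y]
    (φ : X → Y) (x x' : X) : edist (φ x) (φ x') ≤ treePseudoDist φ x x' :=
  le_iInf₂ fun _ _ => le_iInf₂ fun hx hx' =>
    Metric.edist_le_ediam_of_mem (Set.mem_image_of_mem _ hx) (Set.mem_image_of_mem _ hx')

/-- The point `z` is taken from a minimal closed separating subset `G` of a fibre given by Property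
(T). Every connected set containing `x` and `x'` meets `G`, and any two points of `G` are at
`D`-distance zero. -/
theorem PropertyT.exists_separating {X : Type u} {Y : Type v} [MetricSpace X] [MetricSpace Y]
    {C : ℝ≥0} (hX : QuasiConvexSpace C X) (hH : SingularH1Vanishes X ∨ LipschitzH1Vanishes X)
    {φ : X → Y} (hφ : Continuous φ) (hT : PropertyT φ) {x x' : X} (hne : φ x ≠ φ x') :
    ∃ z, φ z ≠ φ x ∧ φ z ≠ φ x' ∧ ∀ K : Set X, IsPreconnected K → x ∈ K → x' ∈ K →
      ∃ k ∈ K, treePseudoDist φ k z = 0 := by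
  obtain ⟨y, hyx, hyx', hy⟩ := hT x x' hne
  have hF : IsClosed (φ ⁻¹' {y}) := isClosed_singleton.preimage hφ
  let 𝒮 : Set (Set X) := {G | IsClosed G ∧ G ⊆ φ ⁻¹' {y} ∧ x' ∉ connectedComponentIn Gᶜ x}
  have hF𝒮 : φ ⁻¹' {y} ∈ 𝒮 := by
    refine ⟨hF, subset_rfl, fun h => ?_⟩
    obtain ⟨c, l, hl, hc, h0, h1, hcF⟩ :=
      hX.joinedByLipschitz_of_mem_connectedComponentIn hF.isOpen_compl h
    let γ : Path x x' := ⟨⟨fun t => c (l * t), by have := hc.continuous; fun_prop⟩, by simp [h0],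
      by simp [h1]⟩
    obtain ⟨t, ht⟩ := hy γ
    exact hcF _ ht
  obtain ⟨G, hGF, hG⟩ := zorn_superset_nonempty 𝒮 (fun c hc𝒮 hchain hcne => by
    refine ⟨⋂₀ c, ⟨isClosed_sInter fun G hG => (hc𝒮 hG).1, ?_, fun h => ?_⟩,
      fun G hG => Set.sInter_subset_of_mem hG⟩
    · obtain ⟨G, hG⟩ := hcne
      exact (Set.sInter_subset_of_mem hG).trans (hc𝒮 hG).2.1
    · obtain ⟨γ, l, hl, hγ, h0, h1, hγG⟩ := hX.joinedByLipschitz_of_mem_connectedComponentIn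
        (isClosed_sInter fun G hG => (hc𝒮 hG).1).isOpen_compl h
      have hcomp : IsCompact (γ '' Set.Icc 0 l) := isCompact_Icc.image hγ.continuous
      -- By compactness, a curve that avoids the intersection of the chain already avoids one of its
      -- members.
      have _ : Nonempty c := hcne.to_subtype
      obtain ⟨⟨G, hG⟩, hGe⟩ := hcomp.elim_directed_family_closed
        (fun G : c => G.1) (fun G => (hc𝒮 G.2).1) (by
          rw [← Set.sInter_eq_iInter, ← Set.disjoint_iff_inter_eq_empty, Set.disjoint_left]
          rintro _ ⟨t, -, rfl⟩
          exact hγG t) (by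
          rintro ⟨A, hA⟩ ⟨B, hB⟩
          rcases hchain.total hA hB with h | h
          exacts [⟨⟨A, hA⟩, subset_rfl, h⟩, ⟨⟨B, hB⟩, h, subset_rfl⟩])
      refine (hc𝒮 hG).2.2 ?_
      refine (isPreconnected_Icc.image γ hγ.continuous.continuousOn).subset_connectedComponentIn
        ⟨0, Set.left_mem_Icc.2 hl, h0⟩ ?_ ⟨l, Set.right_mem_Icc.2 hl, h1⟩
      exact Set.disjoint_left.1 (Set.disjoint_iff_inter_eq_empty.2 hGe)) _ hF𝒮
  obtain ⟨hGc, -, hGs⟩ := hG.prop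
  have hGne : G.Nonempty := by
    by_contra! hGe
    refine hGs ?_
    rw [hGe, Set.compl_empty]
    exact ((hX.joinedByLipschitz x x').mono (Set.subset_univ _)).mem_connectedComponentIn
  obtain ⟨z, hz⟩ := hGne
  have hzy : φ z = y := hGF hz
  refine ⟨z, hzy ▸ hyx, hzy ▸ hyx', fun K hK hxK hx'K => ?_⟩
  have hKG : ∃ k ∈ K, k ∈ G := by
    by_contra! h
    exact hGs (hK.subset_connectedComponentIn hxK h hx'K)
  obtain ⟨k, hkK, hkG⟩ := hKG
  refine ⟨k, hkK, ?_⟩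
  refine le_antisymm (ENNReal.le_of_forall_pos_le_add fun ε hε _ => ?_) bot_le
  rw [zero_add]
  let r : ℝ≥0∞ := ε / 2
  have hr : r ≠ 0 := by simp [r, hε.ne']
  have hN : IsOpen (φ ⁻¹' Metric.eball y r) := Metric.isOpen_eball.preimage hφ
  set N := φ ⁻¹' Metric.eball y r with hNdef
  have hGN : G ⊆ N := fun g hg => by
    have : φ g = y := hGF hg
    simp [N, this, pos_iff_ne_zero, hr]
  have hzz : z ∈ connectedComponentIn N z := mem_connectedComponentIn (hGN hz)
  have hA : IsClosed (G ∩ connectedComponentIn N z) := by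
    have : G ∩ connectedComponentIn N z = G \ (N \ connectedComponentIn N z) := by
      ext g
      simp only [Set.mem_inter_iff, Set.mem_sdiff, not_and, not_not]
      exact ⟨fun h => ⟨h.1, fun _ => h.2⟩, fun h => ⟨h.1, h.2 (hGN h.1)⟩⟩
    rw [this]
    exact hGc.sdiff (hX.isOpen_diff_connectedComponentIn hN z)
  have hB : IsClosed (G \ connectedComponentIn N z) :=
    hGc.sdiff (hX.isOpen_connectedComponentIn hN z)
  -- The component of `z` in `N` splits `G` into two disjoint closed pieces. One of them separates,
  -- by the Janiszewski property, and equals `G` by minimality; it is the piece containing `z`.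
  have hsub : G ⊆ connectedComponentIn N z := by
    by_cases hA' : x' ∈ connectedComponentIn (G ∩ connectedComponentIn N z)ᶜ x
    · by_cases hB' : x' ∈ connectedComponentIn (G \ connectedComponentIn N z)ᶜ x
      · exfalso
        refine hGs ?_
        have := mem_connectedComponentIn_inter hX hH hA.isOpen_compl hB.isOpen_compl (by
          rw [← Set.compl_inter, Set.compl_univ_iff]
          ext g
          simp +contextual) hA' hB'
        rwa [← Set.compl_union, Set.inter_union_sdiff] at this
      · exact absurd hzz (hG.le_of_le ⟨hB, Set.sdiff_subset.trans hGF, hB'⟩ Set.sdiff_subset hz).2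
    · exact (hG.le_of_le ⟨hA, Set.inter_subset_left.trans hGF, hA'⟩ Set.inter_subset_left).trans
        Set.inter_subset_right
  refine (treePseudoDist_le_two_mul (y := y) (r := r) isPreconnected_connectedComponentIn
    (hsub hkG) hzz fun w hw => ?_).trans_eq (ENNReal.mul_div_cancel (by simp) (by simp))
  exact (connectedComponentIn_subset _ _ hw : w ∈ N).le

/-! ### The quotient map onto the tree -/

/-- The quotient map onto the tree. -/
noncomputable def treeMap {X : Type u} {Y : Type v} [MetricSpace X] [MetricSpace Y] (φ : X → Y) (x : X) :
    FactorTree φ :=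
  SeparationQuotient.mk (X := TreeDomain φ) x

theorem edist_treeMap {X : Type u} {Y : Type v} [MetricSpace X] [MetricSpace Y] (φ : X → Y)
    (x x' : X) : edist (treeMap φ x) (treeMap φ x') = treePseudoDist φ x x' :=
  SeparationQuotient.edist_mk _ _

theorem treeMap_surjective {X : Type u} {Y : Type v} [MetricSpace X] [MetricSpace Y] (φ : X → Y) :
    Function.Surjective (treeMap φ) :=
  SeparationQuotient.surjective_mk (X := TreeDomain φ)

theorem continuous_treeMap {X : Type u} {Y : Type v} [MetricSpace X] [MetricSpace Y] {C : ℝ≥0}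
    (hX : QuasiConvexSpace C X) {φ : X → Y} (hφ : Continuous φ) : Continuous (treeMap φ) := by
  refine continuous_iff_continuousAt.2 fun x => EMetric.tendsto_nhds.2 fun ε hε => ?_
  obtain ⟨δ, hδ0, hδ⟩ := ENNReal.lt_iff_exists_nnreal_btwn.1 hε
  have hδ0' : (δ : ℝ≥0∞) / 2 ≠ 0 := by simpa using hδ0.ne'
  obtain ⟨r, hr, h⟩ := hX.eventually_joinedByLipschitz (Metric.isOpen_eball.preimage hφ)
    (show x ∈ φ ⁻¹' Metric.eball (φ x) (δ / 2) by simpa [pos_iff_ne_zero] using hδ0.ne')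
  filter_upwards [Metric.eball_mem_nhds x hr] with z hz
  rw [edist_comm, edist_treeMap]
  have hz' := (h z (by rwa [edist_comm])).mem_connectedComponentIn
  refine lt_of_le_of_lt ?_ hδ
  refine (treePseudoDist_le_two_mul (y := φ x) (r := δ / 2) isPreconnected_connectedComponentIn
    (mem_connectedComponentIn ?_) hz' fun w hw => ?_).trans_eq
    (ENNReal.mul_div_cancel (by simp) (by simp))
  · simpa [pos_iff_ne_zero] using hδ0.ne'
  · exact (connectedComponentIn_subset _ _ hw : w ∈ φ ⁻¹' _).le

theorem mem_connectedComponentIn_of_treePseudoDist_lt {X : Type u} {Y : Type v} [MetricSpace X]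
    [MetricSpace Y] {φ : X → Y} {V : Set (FactorTree φ)} {r : ℝ≥0∞} {x x' : X}
    (hV : Metric.eball (treeMap φ x) r ⊆ V) (h : treePseudoDist φ x x' < r) :
    x' ∈ connectedComponentIn (treeMap φ ⁻¹' V) x := by
  unfold treePseudoDist at h
  simp only [iInf_lt_iff] at h
  obtain ⟨K, hK, hxK, hx'K, hd⟩ := h
  refine hK.isPreconnected.subset_connectedComponentIn hxK (fun k hk => hV ?_) hx'K
  rw [Metric.mem_eball, edist_comm, edist_treeMap]
  exact (treePseudoDist_le_of_subset hK.isPreconnected hxK hk).trans_lt hd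

/-- Connected sets of the tree lift to connected sets of the domain, up to a neighbourhood. -/
theorem mem_connectedComponentIn_preimage_treeMap {X : Type u} {Y : Type v} [MetricSpace X]
    [MetricSpace Y] {φ : X → Y} {K V : Set (FactorTree φ)} (hV : IsOpen V) (hK : IsPreconnected K)
    (hKV : K ⊆ V) {x x' : X} (hx : treeMap φ x ∈ K) (hx' : treeMap φ x' ∈ K) :
    x' ∈ connectedComponentIn (treeMap φ ⁻¹' V) x := by
  set U := treeMap φ ⁻¹' V with hU
  have hball (w : X) (hw : w ∈ U) : ∃ r > 0, Metric.eball (treeMap φ w) r ⊆ V ∧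
      ∀ w', edist (treeMap φ w) (treeMap φ w') < r → w' ∈ connectedComponentIn U w := by
    obtain ⟨r, hr, hrV⟩ := EMetric.isOpen_iff.1 hV _ hw
    exact ⟨r, hr, hrV, fun w' hw' => mem_connectedComponentIn_of_treePseudoDist_lt hrV (by
      rwa [← edist_treeMap])⟩
  -- Points of `U` that are close for `D` lie in one component of `U`. So the images of the
  -- component of `x` and of the rest of `U` are open and disjoint, and `K` cannot meet both.
  let A : Set (FactorTree φ) := treeMap φ '' connectedComponentIn U x
  let B : Set (FactorTree φ) := treeMap φ '' (U \ connectedComponentIn U x)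
  have hA : IsOpen A := by
    refine EMetric.isOpen_iff.2 ?_
    rintro _ ⟨w, hw, rfl⟩
    obtain ⟨r, hr, -, h⟩ := hball w (connectedComponentIn_subset _ _ hw)
    refine ⟨r, hr, fun q hq => ?_⟩
    obtain ⟨w', rfl⟩ := treeMap_surjective φ q
    refine ⟨w', ?_, rfl⟩
    rw [connectedComponentIn_eq hw]
    exact h w' (by rwa [edist_comm])
  have hB : IsOpen B := by
    refine EMetric.isOpen_iff.2 ?_
    rintro _ ⟨w, hw, rfl⟩
    obtain ⟨r, hr, -, h⟩ := hball w hw.1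
    refine ⟨r, hr, fun q hq => ?_⟩
    obtain ⟨w', rfl⟩ := treeMap_surjective φ q
    have hw' := h w' (by rwa [edist_comm])
    refine ⟨w', ⟨connectedComponentIn_subset _ _ hw', fun hx => hw.2 ?_⟩, rfl⟩
    rw [connectedComponentIn_eq hx, ← connectedComponentIn_eq hw']
    exact mem_connectedComponentIn hw.1
  have hfib {w w' : X} (hw : w ∈ U) (h : treeMap φ w = treeMap φ w') :
      w' ∈ connectedComponentIn U w := by
    obtain ⟨r, hr, -, h'⟩ := hball w hw
    exact h' w' (by simpa [h] using hr)
  have hAB : Disjoint A B := by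
    rw [Set.disjoint_left]
    rintro _ ⟨w, hw, rfl⟩ ⟨w', hw', h⟩
    refine hw'.2 ?_
    rw [connectedComponentIn_eq hw]
    exact hfib (connectedComponentIn_subset _ _ hw) h.symm
  have hsub : K ⊆ A ∪ B := fun p hp => by
    obtain ⟨w, rfl⟩ := treeMap_surjective φ p
    by_cases hw : w ∈ connectedComponentIn U x
    exacts [Or.inl ⟨w, hw, rfl⟩, Or.inr ⟨w, ⟨hKV hp, hw⟩, rfl⟩]
  obtain ⟨w, hw, h⟩ := hK.subset_left_of_subset_union hA hB hAB hsub
    ⟨_, hx, x, mem_connectedComponentIn (hKV hx), rfl⟩ hx'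
  rw [connectedComponentIn_eq hw]
  exact hfib (connectedComponentIn_subset _ _ hw) h

/-- A nondegenerate connected set of the tree contains two points that are separated by a third
one. -/
theorem PropertyT.exists_cut_point {X : Type u} {Y : Type v} [MetricSpace X] [MetricSpace Y]
    {C : ℝ≥0} (hX : QuasiConvexSpace C X) (hH : SingularH1Vanishes X ∨ LipschitzH1Vanishes X)
    {φ : X → Y} (hφ : Continuous φ) (hT : PropertyT φ) {K : Set (FactorTree φ)}
    (hK : IsPreconnected K) (hKn : K.Nontrivial) :
    ∃ p ∈ K, ∃ q ∈ K, ∃ w, w ≠ p ∧ w ≠ q ∧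
      ∀ K' : Set (FactorTree φ), IsPreconnected K' → p ∈ K' → q ∈ K' → w ∈ K' := by
  have hlip : ∀ x x' : X, edist (φ x) (φ x') ≤ edist (treeMap φ x) (treeMap φ x') := fun x x' =>
    (edist_le_treePseudoDist φ x x').trans_eq (edist_treeMap φ x x').symm
  -- If `φ` were constant over `K`, then lifting `K` to a connected set over its `ε/2`-neighbourhood
  -- would bound all `D`-distances in `K` by `ε`.
  have hφK : ∃ x x' : X, treeMap φ x ∈ K ∧ treeMap φ x' ∈ K ∧ φ x ≠ φ x' := by
    by_contra! hconst
    obtain ⟨p, hp, q, hq, hpq⟩ := hKn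
    obtain ⟨x, rfl⟩ := treeMap_surjective φ p
    obtain ⟨x', rfl⟩ := treeMap_surjective φ q
    refine hpq (edist_le_zero.1 (ENNReal.le_of_forall_pos_le_add fun ε hε _ => ?_))
    rw [zero_add, edist_treeMap]
    have hr : (ε : ℝ≥0∞) / 2 ≠ 0 := by simp [hε.ne']
    let V : Set (FactorTree φ) := ⋃ p ∈ K, Metric.eball p (ε / 2)
    have hx' := mem_connectedComponentIn_preimage_treeMap (V := V)
      (isOpen_biUnion fun _ _ => Metric.isOpen_eball) hK (fun p hp => by
        simp only [V, Set.mem_iUnion]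
        exact ⟨p, hp, Metric.mem_eball_self (pos_iff_ne_zero.2 hr)⟩) hp hq
    have hxV : x ∈ treeMap φ ⁻¹' V := by
      simp only [V, Set.mem_preimage, Set.mem_iUnion]
      exact ⟨_, hp, Metric.mem_eball_self (pos_iff_ne_zero.2 hr)⟩
    refine (treePseudoDist_le_two_mul (y := φ x) (r := ε / 2) isPreconnected_connectedComponentIn
      (mem_connectedComponentIn hxV) hx' fun w hw => ?_).trans_eq
      (ENNReal.mul_div_cancel (by simp) (by simp))
    have hwV : treeMap φ w ∈ V := connectedComponentIn_subset (treeMap φ ⁻¹' V) _ hw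
    simp only [V, Set.mem_iUnion] at hwV
    obtain ⟨p, hpK, hwp⟩ := hwV
    obtain ⟨x1, rfl⟩ := treeMap_surjective φ p
    rw [hconst x x1 hp hpK]
    exact (hlip w x1).trans (Metric.mem_eball.1 hwp).le
  obtain ⟨x, x', hx, hx', hne⟩ := hφK
  obtain ⟨z, hzx, hzx', hz⟩ := hT.exists_separating hX hH hφ hne
  refine ⟨_, hx, _, hx', treeMap φ z, fun h => hzx ?_, fun h => hzx' ?_, fun K' hK' hp hq => ?_⟩
  · exact edist_le_zero.1 ((hlip z x).trans_eq (by rw [h, edist_self]))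
  · exact edist_le_zero.1 ((hlip z x').trans_eq (by rw [h, edist_self]))
  · by_contra hzK'
    -- A connected set missing the image of `z` would lift to a connected set joining `x` to `x'`
    -- off the fibre of that image.
    have hmem := mem_connectedComponentIn_preimage_treeMap (V := {treeMap φ z}ᶜ)
      isOpen_compl_singleton hK' (fun p hp h => hzK' (by rwa [← show p = _ from h])) hp hq
    obtain ⟨k, hk, hkz⟩ := hz _ (isPreconnected_connectedComponentIn (x := x)
      (F := treeMap φ ⁻¹' {treeMap φ z}ᶜ)) (mem_connectedComponentIn fun h => hzK' (by
        rwa [← show treeMap φ x = _ from h])) hmem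
    refine connectedComponentIn_subset _ _ hk (edist_le_zero.1 ?_)
    rw [edist_treeMap, hkz]
/-! ### Arcs in path connected metrizable spaces -/

/-- A curve with connected fibres between distinct points can be reparametrized to an injective
curve. -/
theorem exists_injective_path_of_connected_fibers {T : Type u} [MetricSpace T] {p q : T}
    (hpq : p ≠ q) (G : Path p q) (hG : ∀ s u t, s ≤ u → u ≤ t → G s = G t → G u = G s) :
    ∃ γ : Path p q, Function.Injective γ := by
  -- `k a t` is the largest distance from `G a` reached on `[a, t]`, and `0` for `t ≤ a`. The
  -- lattice expression makes the supremum run over a fixed compact set, which gives continuity in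
  -- `t`.
  let k : unitInterval → unitInterval → ℝ := fun a t =>
    sSup ((fun s => dist (G a) (G (a ⊔ (s ⊓ t)))) '' Set.univ)
  have hkc (a : unitInterval) : Continuous (k a) :=
    isCompact_univ.continuous_sSup (f := fun t s => dist (G a) (G (a ⊔ (s ⊓ t)))) (by
      have := G.continuous
      fun_prop)
  obtain ⟨M, hM⟩ := Metric.isBounded_iff.1 (isCompact_range G.continuous).isBounded
  replace hM (s t : unitInterval) : dist (G s) (G t) ≤ M :=
    hM (Set.mem_range_self _) (Set.mem_range_self _)
  have hle (a t u : unitInterval) (hau : a ≤ u) (hut : u ≤ t) : dist (G a) (G u) ≤ k a t := by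
    refine le_csSup ⟨M, ?_⟩ ⟨u, trivial, ?_⟩
    · rintro _ ⟨s, -, rfl⟩
      exact hM _ _
    · simp [inf_eq_left.2 hut, sup_eq_right.2 hau]
  have hk0 (a t : unitInterval) : 0 ≤ k a t := by
    refine Real.sSup_nonneg ?_
    rintro _ ⟨s, -, rfl⟩
    exact dist_nonneg
  have hk_le (a t : unitInterval) (r : ℝ) (hr : 0 ≤ r)
      (h : ∀ u, a ≤ u → u ≤ t → dist (G a) (G u) ≤ r) : k a t ≤ r := by
    refine csSup_le ⟨_, 0, trivial, rfl⟩ ?_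
    rintro _ ⟨s, -, rfl⟩
    rcases le_total a (s ⊓ t) with hs | hs
    · exact h _ le_sup_left (by rw [sup_eq_right.2 hs]; exact inf_le_right)
    · simpa [sup_eq_left.2 hs] using hr
  have hkmono (a : unitInterval) : Monotone (k a) := fun s t hst =>
    hk_le a s _ (hk0 a t) fun u hau hus => hle a t u hau (hus.trans hst)
  have hkM (a t : unitInterval) : k a t ≤ M :=
    hk_le a t M (dist_nonneg.trans (hM a a)) fun u _ _ => hM _ _
  have hkconst (a s t : unitInterval) (hst : s ≤ t) (h : G s = G t) : k a s = k a t := by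
    refine le_antisymm (hkmono a hst) (hk_le a t _ (hk0 a s) fun u hau hut => ?_)
    rcases le_total u s with hus | hsu
    · exact hle a s u hau hus
    · rw [hG s u t hsu hut h]
      rcases le_total a s with has | hsa
      · exact hle a s s has le_rfl
      · rw [hG s a t hsa (hau.trans hut) h, dist_self]
        exact hk0 a s
  let d : ℕ → unitInterval := TopologicalSpace.denseSeq unitInterval
  -- A monotone continuous function with exactly the fibres of `G`: if `G s ≠ G t`, some dense `a`
  -- in `(s, t)` has `G a ≠ G t`, and its term strictly increases.
  let h : unitInterval → ℝ := fun t => ∑' n, (1 / 2) ^ n * k (d n) t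
  have hsum : Summable fun n : ℕ => ((1 / 2 : ℝ) ^ n * M) :=
    (summable_geometric_of_lt_one (by norm_num) (by norm_num)).mul_right M
  have hsum' (t : unitInterval) : Summable fun n : ℕ => ((1 / 2 : ℝ) ^ n * k (d n) t) :=
    hsum.of_nonneg_of_le (fun n => mul_nonneg (by positivity) (hk0 _ _))
      fun n => mul_le_mul_of_nonneg_left (hkM _ _) (by positivity)
  have hc : Continuous h := by
    refine continuous_tsum (fun n => continuous_const.mul (hkc _)) hsum fun n t => ?_
    rw [Real.norm_of_nonneg (mul_nonneg (by positivity) (hk0 _ _))]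
    exact mul_le_mul_of_nonneg_left (hkM _ _) (by positivity)
  have hmono : Monotone h := fun s t hst => (hsum' s).tsum_le_tsum
    (fun n => mul_le_mul_of_nonneg_left (hkmono _ hst) (by positivity)) (hsum' t)
  have hconst (s t : unitInterval) (hst : s ≤ t) (hG' : G s = G t) : h s = h t :=
    tsum_congr fun n => by rw [hkconst _ s t hst hG']
  have hstrict (s t : unitInterval) (hst : s < t) (hne : G s ≠ G t) : h s < h t := by
    have hs : s ∈ closure (Set.Ioo s t) := by
      rw [closure_Ioo hst.ne]
      exact Set.left_mem_Icc.2 hst.le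
    have hO : IsOpen {a | G a ≠ G t} := isOpen_ne_fun G.continuous continuous_const
    have hO' : (Set.Ioo s t ∩ {a | G a ≠ G t}).Nonempty := by
      rw [Set.inter_comm]
      exact mem_closure_iff.1 hs _ hO hne
    obtain ⟨n, hn, hn'⟩ := (TopologicalSpace.denseRange_denseSeq unitInterval).exists_mem_open
      (isOpen_Ioo.inter hO) hO'
    refine (hsum' s).tsum_lt_tsum (i := n)
      (fun n => mul_le_mul_of_nonneg_left (hkmono _ hst.le) (by positivity)) ?_ (hsum' t)
    refine mul_lt_mul_of_pos_left ?_ (by positivity)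
    have h1 : k (d n) s ≤ 0 := hk_le _ _ _ le_rfl fun u hu hus =>
      absurd (hu.trans hus) (not_le.2 hn.1)
    exact h1.trans_lt ((dist_pos.2 hn').trans_le (hle _ _ _ hn.2.le le_rfl))
  have h01 : h 0 < h 1 := hstrict 0 1 zero_lt_one (by simpa using hpq)
  have hpos : 0 < h 1 - h 0 := sub_pos.2 h01
  let H : unitInterval → unitInterval := fun t => ⟨(h t - h 0) / (h 1 - h 0),
    div_nonneg (sub_nonneg.2 (hmono unitInterval.nonneg')) hpos.le,
    (div_le_one hpos).2 (by linarith [hmono (unitInterval.le_one' (t := t))])⟩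
  have hHc : Continuous H := by
    refine Continuous.subtype_mk ?_ _
    fun_prop
  have hH0 : H 0 = 0 := by ext; simp [H]
  have hH1 : H 1 = 1 := by ext; simp [H, hpos.ne']
  have hHeq (s t : unitInterval) : H s = H t ↔ h s = h t := by
    simp [H, Subtype.ext_iff, div_left_inj' hpos.ne']
  have hHsurj : Function.Surjective H := fun y => by
    have := intermediate_value_univ 0 1 hHc
    exact this ⟨by rw [hH0]; exact unitInterval.nonneg', by rw [hH1]; exact unitInterval.le_one'⟩
  have hHG (s t : unitInterval) : H s = H t ↔ G s = G t := by
    rw [hHeq]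
    rcases lt_trichotomy s t with hst | rfl | hst
    · exact ⟨fun h => by_contra fun hne => (hstrict s t hst hne).ne h, hconst s t hst.le⟩
    · simp
    · exact ⟨fun h => by_contra fun hne => (hstrict t s hst (Ne.symm hne)).ne' h,
        fun h => (hconst t s hst.le h.symm).symm⟩
  -- `R` need not be continuous, but `G ∘ R` is, since it is `G` descended along the quotient map
  -- `H`.
  obtain ⟨R, hR⟩ := hHsurj.hasRightInverse
  have hquot : Topology.IsQuotientMap H := hHc.isClosedMap.isQuotientMap hHc hHsurj
  have hα (t : unitInterval) : G (R (H t)) = G t := (hHG _ _).1 (hR _)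
  refine ⟨⟨⟨G ∘ R, ?_⟩, ?_, ?_⟩, fun s t hst => ?_⟩
  · rw [hquot.continuous_iff]
    exact G.continuous.congr fun t => (hα t).symm
  · simpa [hH0] using hα 0
  · simpa [hH1] using hα 1
  · have := (hHG (R s) (R t)).2 hst
    rwa [hR, hR] at this

/-- Loop erasure by Zorn: `K` is minimal among closed sets containing `0` and `1` such that `g`
agrees at the two ends of each gap. If `g s = g t`, deleting `K ∩ (s, t)` keeps this property, so
nothing was there to delete. -/
theorem exists_minimal_gap_set {T : Type u} [MetricSpace T] (g : ℝ → T) (hg : Continuous g) :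
    ∃ K : Set ℝ, IsClosed K ∧ K ⊆ Set.Icc 0 1 ∧ 0 ∈ K ∧ 1 ∈ K ∧
      ∀ s ∈ K, ∀ t ∈ K, s < t → (g s = g t ↔ Disjoint (Set.Ioo s t) K) := by
  let 𝓕 : Set (Set ℝ) := {K | IsClosed K ∧ K ⊆ Set.Icc 0 1 ∧ 0 ∈ K ∧ 1 ∈ K ∧
      ∀ s ∈ K, ∀ t ∈ K, s < t → Disjoint (Set.Ioo s t) K → g s = g t}
  have hI : Set.Icc (0 : ℝ) 1 ∈ 𝓕 := by
    refine ⟨isClosed_Icc, subset_rfl, by simp, by simp, fun s hs t ht hst hd => ?_⟩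
    obtain ⟨u, hu⟩ := exists_between hst
    exact absurd ⟨hs.1.trans hu.1.le, hu.2.le.trans ht.2⟩ (Set.disjoint_left.1 hd hu)
  obtain ⟨K, -, hK⟩ := zorn_superset_nonempty 𝓕 (fun c hc𝓕 hchain hcne => by
    obtain ⟨M0, hM0⟩ := hcne
    refine ⟨⋂₀ c, ⟨isClosed_sInter fun M hM => (hc𝓕 hM).1, (Set.sInter_subset_of_mem hM0).trans
      (hc𝓕 hM0).2.1, fun M hM => (hc𝓕 hM).2.2.1, fun M hM => (hc𝓕 hM).2.2.2.1,
      fun a ha b hb hab hd => ?_⟩, fun M hM => Set.sInter_subset_of_mem hM⟩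
    refine eq_of_forall_dist_le fun ε hε => ?_
    have hε2 : 0 < ε / 2 := by linarith
    obtain ⟨δ, hδ, hδa⟩ := Metric.continuous_iff.1 hg a (ε / 2) hε2
    obtain ⟨δ', hδ', hδb⟩ := Metric.continuous_iff.1 hg b (ε / 2) hε2
    obtain ⟨m, hm⟩ := exists_between hab
    obtain ⟨a', ha'⟩ := exists_between (lt_min hm.1 (show a < a + δ by linarith))
    obtain ⟨b', hb'⟩ := exists_between (max_lt hm.2 (show b - δ' < b by linarith))
    have ha'm := ha'.2.trans_le (min_le_left _ _)
    have ha'δ := ha'.2.trans_le (min_le_right _ _)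
    have hb'm := (le_max_left _ _).trans_lt hb'.1
    have hb'δ := (le_max_right _ _).trans_lt hb'.1
    have _ : Nonempty c := ⟨⟨M0, hM0⟩⟩
    -- A gap `(a, b)` of the intersection is nearly a gap of some member `M`: by compactness `M`
    -- misses `[a', b']`, and the points of `M` nearest to this interval on either side bound a gap
    -- of `M` with ends close to `a` and `b`.
    obtain ⟨⟨M, hM⟩, hMe⟩ := (isCompact_Icc (a := a') (b := b')).elim_directed_family_closed
      (fun M : c => M.1) (fun M => (hc𝓕 M.2).1) (by
        rw [← Set.sInter_eq_iInter, ← Set.disjoint_iff_inter_eq_empty]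
        exact hd.mono_left (Set.Icc_subset_Ioo ha'.1 hb'.2)) (by
        rintro ⟨A, hA⟩ ⟨B, hB⟩
        rcases hchain.total hA hB with h | h
        exacts [⟨⟨A, hA⟩, subset_rfl, h⟩, ⟨⟨B, hB⟩, h, subset_rfl⟩])
    have hMd := Set.disjoint_left.1 (Set.disjoint_iff_inter_eq_empty.2 hMe)
    have hMc := (hc𝓕 hM).1
    have hca : IsCompact (M ∩ Set.Icc a a') := isCompact_Icc.inter_left hMc
    have hcb : IsCompact (M ∩ Set.Icc b' b) := isCompact_Icc.inter_left hMc
    have ha1 := hca.sSup_mem ⟨a, ha M hM, le_rfl, ha'.1.le⟩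
    have hb1 := hcb.sInf_mem ⟨b, hb M hM, hb'.2.le, le_rfl⟩
    have ha1' := fun t ht => le_csSup hca.bddAbove (a := t) ht
    have hb1' := fun t ht => csInf_le hcb.bddBelow (a := t) ht
    set a1 := sSup (M ∩ Set.Icc a a')
    set b1 := sInf (M ∩ Set.Icc b' b)
    have hgab : g a1 = g b1 := by
      refine (hc𝓕 hM).2.2.2.2 a1 ha1.1 b1 hb1.1 (by linarith [ha1.2.2, hb1.2.1]) ?_
      rw [Set.disjoint_left]
      intro t ht htM
      rcases le_total t a' with h | h
      · exact ht.1.not_ge (ha1' t ⟨htM, ha1.2.1.trans ht.1.le, h⟩)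
      · rcases le_total b' t with h' | h'
        · exact ht.2.not_ge (hb1' t ⟨htM, h', ht.2.le.trans hb1.2.2⟩)
        · exact hMd ⟨h, h'⟩ htM
    have h1 := hδa a1 (by
      rw [Real.dist_eq, abs_of_nonneg (by linarith [ha1.2.1])]; linarith [ha1.2.2])
    have h2 := hδb b1 (by
      rw [Real.dist_eq, abs_of_nonpos (by linarith [hb1.2.2])]; linarith [hb1.2.1])
    rw [hgab] at h1
    linarith [dist_triangle_left (g a) (g b) (g b1)]) _ hI
  obtain ⟨hKc, hKI, h0, h1, hgap⟩ := hK.prop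
  refine ⟨K, hKc, hKI, h0, h1, fun s hs t ht hst => ⟨fun hg' => ?_, hgap s hs t ht hst⟩⟩
  have hmem : K \ Set.Ioo s t ∈ 𝓕 := by
    refine ⟨hKc.sdiff isOpen_Ioo, Set.sdiff_subset.trans hKI, ⟨h0, fun h => h.1.not_ge (hKI hs).1⟩,
      ⟨h1, fun h => h.2.not_ge (hKI ht).2⟩, fun a ha b hb hab hd => ?_⟩
    by_cases hd' : Disjoint (Set.Ioo a b) K
    · exact hgap a ha.1 b hb.1 hab hd'
    · obtain ⟨w, hw, hwK⟩ := Set.not_disjoint_iff.1 hd'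
      have hwst : w ∈ Set.Ioo s t := by
        by_contra h
        exact Set.disjoint_left.1 hd hw ⟨hwK, h⟩
      have hs' : ¬ (a < s) := fun h => Set.disjoint_left.1 hd (show s ∈ Set.Ioo a b from ⟨h, hwst.1.trans hw.2⟩)
        ⟨hs, fun h => h.1.false⟩
      have ht' : ¬ (t < b) := fun h => Set.disjoint_left.1 hd (show t ∈ Set.Ioo a b from ⟨hw.1.trans hwst.2, h⟩)
        ⟨ht, fun h => h.2.false⟩
      have ha' : ¬ (s < a) := fun h => ha.2 ⟨h, hw.1.trans hwst.2⟩
      have hb' : ¬ (b < t) := fun h => hb.2 ⟨hwst.1.trans hw.2, h⟩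
      rw [le_antisymm (not_lt.1 ha') (not_lt.1 hs'), le_antisymm (not_lt.1 ht') (not_lt.1 hb'), hg']
  exact Set.disjoint_right.2 fun w hw => (hK.le_of_le hmem Set.sdiff_subset hw).2

/-- Distinct points of a metric space that are joined by a curve are joined by an injective
curve. -/
theorem Path.exists_injective {T : Type u} [MetricSpace T] {p q : T} (hpq : p ≠ q)
    (γ : Path p q) : ∃ γ' : Path p q, Function.Injective γ' := by
  let g : ℝ → T := γ.extend
  have hg : Continuous g := γ.continuous_extend
  obtain ⟨K, hKc, hKI, h0, h1, hK⟩ := exists_minimal_gap_set g hg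
  have hcr (t : ℝ) : IsCompact (K ∩ Set.Icc 0 t) := isCompact_Icc.inter_left hKc
  have hcl (t : ℝ) : IsCompact (K ∩ Set.Icc t 1) := isCompact_Icc.inter_left hKc
  -- `r t` and `l t` are the neighbours of `t` in `K` on the left and the right. The curve `g ∘ r`
  -- is constant across gaps and has connected fibres.
  let r : ℝ → ℝ := fun t => sSup (K ∩ Set.Icc 0 t)
  let l : ℝ → ℝ := fun t => sInf (K ∩ Set.Icc t 1)
  have hr {t : ℝ} (ht : t ∈ Set.Icc (0 : ℝ) 1) : r t ∈ K ∩ Set.Icc 0 t :=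
    (hcr t).sSup_mem ⟨0, h0, le_rfl, ht.1⟩
  have hl {t : ℝ} (ht : t ∈ Set.Icc (0 : ℝ) 1) : l t ∈ K ∩ Set.Icc t 1 :=
    (hcl t).sInf_mem ⟨1, h1, ht.2, le_rfl⟩
  have hr' {t u : ℝ} (hu : u ∈ K) (hut : u ≤ t) : u ≤ r t :=
    le_csSup (hcr t).bddAbove ⟨hu, (hKI hu).1, hut⟩
  have hl' {t u : ℝ} (hu : u ∈ K) (hut : t ≤ u) : l t ≤ u :=
    csInf_le (hcl t).bddBelow ⟨hu, hut, (hKI hu).2⟩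
  have hrl {t : ℝ} (ht : t ∈ Set.Icc (0 : ℝ) 1) : g (r t) = g (l t) := by
    rcases ((hr ht).2.2.trans (hl ht).2.1).eq_or_lt with h | h
    · rw [h]
    · refine (hK _ (hr ht).1 _ (hl ht).1 h).2 (Set.disjoint_left.2 fun u hu huK => ?_)
      rcases le_total u t with hut | hut
      · exact hu.1.not_ge (hr' huK hut)
      · exact hu.2.not_ge (hl' huK hut)
  have hosc {s t : ℝ} (hs : s ∈ Set.Icc (0 : ℝ) 1) (ht : t ∈ Set.Icc (0 : ℝ) 1) (hst : s ≤ t) :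
      g (r s) = g (r t) ∨ ∃ s' ∈ Set.Icc s t, ∃ t' ∈ Set.Icc s t, g (r s) = g s' ∧
        g (r t) = g t' := by
    rcases le_total (r t) s with h | h
    · exact Or.inl (congrArg g (le_antisymm (hr' (hr hs).1 ((hr hs).2.2.trans hst))
        (hr' (hr ht).1 h)))
    · exact Or.inr ⟨l s, ⟨(hl hs).2.1, (hl' (hr ht).1 h).trans (hr ht).2.2⟩, r t,
        ⟨h, (hr ht).2.2⟩, hrl hs, rfl⟩
  have hcont : Continuous fun t : unitInterval => g (r t) := by
    have huc := isCompact_Icc.uniformContinuousOn_of_continuous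
      (hg.continuousOn (s := Set.Icc (0 : ℝ) 1))
    rw [Metric.uniformContinuousOn_iff] at huc
    refine Metric.continuous_iff.2 fun t ε hε => ?_
    obtain ⟨δ, hδ, h⟩ := huc ε hε
    have key (s t : unitInterval) (hst : s ≤ t) (hd : dist s t < δ) :
        dist (g (r s)) (g (r t)) < ε := by
      rcases hosc s.2 t.2 hst with h' | ⟨s', hs', t', ht', e, e'⟩
      · rwa [h', dist_self]
      · rw [e, e']
        refine h s' ⟨s.2.1.trans hs'.1, hs'.2.trans t.2.2⟩ t'
          ⟨s.2.1.trans ht'.1, ht'.2.trans t.2.2⟩ (lt_of_le_of_lt ?_ hd)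
        rw [dist_comm s t]
        exact (Real.dist_le_of_mem_Icc hs' ht').trans (le_abs_self _)
    refine ⟨δ, hδ, fun s hs => ?_⟩
    rcases le_total s t with hst | hst
    · exact key s t hst hs
    · rw [dist_comm]
      exact key t s hst (by rwa [dist_comm])
  have hr0 : r 0 = 0 := by
    have := hr (t := 0) (by simp)
    exact le_antisymm this.2.2 this.2.1
  have hr1 : r 1 = 1 := le_antisymm (hr (t := 1) (by simp)).2.2 (hr' h1 le_rfl)
  refine exists_injective_path_of_connected_fibers hpq ⟨⟨fun t => g (r t), hcont⟩, ?_, ?_⟩ ?_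
  · simp [hr0, g]
  · simp [hr1, g]
  · intro s u t hsu hut h
    change g (r s) = g (r t) at h
    change g (r u) = g (r s)
    have hs := hr s.2
    have hu := hr u.2
    have ht := hr t.2
    have h1 : r s ≤ r u := hr' hs.1 (hs.2.2.trans hsu)
    have h2 : r u ≤ r t := hr' hu.1 (hu.2.2.trans hut)
    rcases h1.eq_or_lt with e | h1
    · rw [e]
    rcases h2.eq_or_lt with e | h2
    · rw [e, h]
    exact absurd hu.1 (Set.disjoint_left.1 ((hK _ hs.1 _ ht.1 (h1.trans h2)).1 h) ⟨h1, h2⟩)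
/-! ### Trees: arcs and projections -/

/-- Every nondegenerate connected set contains two points separated by a third point. -/
def HasCutPoints (T : Type u) [TopologicalSpace T] : Prop :=
  ∀ K : Set T, IsPreconnected K → K.Nontrivial → ∃ p ∈ K, ∃ q ∈ K, ∃ w, w ≠ p ∧ w ≠ q ∧
    ∀ M : Set T, IsPreconnected M → p ∈ M → q ∈ M → w ∈ M

/-- The intersection of all closed connected sets that contain `p` and `q`. -/
def arcHull {T : Type u} [TopologicalSpace T] (p q : T) : Set T :=
  ⋂₀ {K | IsClosed K ∧ IsPreconnected K ∧ p ∈ K ∧ q ∈ K}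

section ArcHull

variable {T : Type u} [TopologicalSpace T]

theorem arcHull_subset {p q : T} {K : Set T} (hKc : IsClosed K) (hK : IsPreconnected K)
    (hp : p ∈ K) (hq : q ∈ K) : arcHull p q ⊆ K :=
  Set.sInter_subset_of_mem ⟨hKc, hK, hp, hq⟩

theorem isClosed_arcHull (p q : T) : IsClosed (arcHull p q) :=
  isClosed_sInter fun _ hK => hK.1

theorem left_mem_arcHull (p q : T) : p ∈ arcHull p q :=
  Set.mem_sInter.2 fun _ hK => hK.2.2.1

theorem right_mem_arcHull (p q : T) : q ∈ arcHull p q :=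
  Set.mem_sInter.2 fun _ hK => hK.2.2.2

theorem arcHull_comm (p q : T) : arcHull p q = arcHull q p := by
  simp only [arcHull, and_comm (a := p ∈ _)]

theorem arcHull_self [T1Space T] (p : T) : arcHull p p = {p} :=
  (arcHull_subset isClosed_singleton isPreconnected_singleton rfl rfl).antisymm
    (Set.singleton_subset_iff.2 (left_mem_arcHull p p))

/-- If the curve leaves `K`, a short subarc misses `K` and contains two points separated by some
`w`, which then lies strictly between them on the arc. The detour along the two outer pieces of the
curve and through `K` joins these points and avoids `w`. -/
theorem HasCutPoints.range_subset (hT : HasCutPoints T) {p q : T} {γ : Path p q}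
    (hγ : Function.Injective γ) {K : Set T} (hKc : IsClosed K) (hK : IsPreconnected K)
    (hp : p ∈ K) (hq : q ∈ K) : Set.range γ ⊆ K := by
  rintro _ ⟨t0, rfl⟩
  by_contra ht0
  have ht01 : t0 < 1 := lt_of_le_of_ne unitInterval.le_one' fun h => ht0 (by simpa [h] using hq)
  have hO : γ ⁻¹' Kᶜ ∈ nhds t0 := (hKc.isOpen_compl.preimage γ.continuous).mem_nhds ht0
  obtain ⟨u, hu, hsub⟩ := exists_Ico_subset_of_mem_nhds hO ⟨1, ht01⟩
  obtain ⟨t2, ht2, ht2u⟩ := exists_between hu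
  have hI : ∀ t ∈ Set.Icc t0 t2, γ t ∉ K := fun t ht => hsub ⟨ht.1, ht.2.trans_lt ht2u⟩
  obtain ⟨_, ⟨s1, hs1, rfl⟩, _, ⟨s2, hs2, rfl⟩, w, hw1, hw2, hw⟩ :=
    hT (γ '' Set.Icc t0 t2) (isPreconnected_Icc.image _ γ.continuous.continuousOn)
      ⟨γ t0, ⟨t0, ⟨le_rfl, ht2.le⟩, rfl⟩, γ t2, ⟨t2, ⟨ht2.le, le_rfl⟩, rfl⟩, hγ.ne ht2.ne⟩
  have key (s1 s2 : unitInterval) (hs1 : s1 ∈ Set.Icc t0 t2) (hs2 : s2 ∈ Set.Icc t0 t2)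
      (hs : s1 ≤ s2) (hw1 : w ≠ γ s1) (hw2 : w ≠ γ s2)
      (hw : ∀ K' : Set T, IsPreconnected K' → γ s1 ∈ K' → γ s2 ∈ K' → w ∈ K') : False := by
    obtain ⟨s, hs', rfl⟩ := hw _ (isPreconnected_Icc.image _ γ.continuous.continuousOn)
      ⟨s1, ⟨le_rfl, hs⟩, rfl⟩ ⟨s2, ⟨hs, le_rfl⟩, rfl⟩
    have hc1 : IsPreconnected (γ '' Set.Icc 0 s1) :=
      isPreconnected_Icc.image _ γ.continuous.continuousOn
    have hc2 : IsPreconnected (γ '' Set.Icc s2 1) :=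
      isPreconnected_Icc.image _ γ.continuous.continuousOn
    have hpm : p ∈ γ '' Set.Icc 0 s1 := ⟨0, ⟨le_rfl, unitInterval.nonneg'⟩, γ.source⟩
    have hqm : q ∈ γ '' Set.Icc s2 1 := ⟨1, ⟨unitInterval.le_one', le_rfl⟩, γ.target⟩
    have hs1m : γ s1 ∈ γ '' Set.Icc 0 s1 := ⟨s1, ⟨unitInterval.nonneg', le_rfl⟩, rfl⟩
    have hs2m : γ s2 ∈ γ '' Set.Icc s2 1 := ⟨s2, ⟨le_rfl, unitInterval.le_one'⟩, rfl⟩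
    rcases hw _ ((hc1.union p hpm hp hK).union q (Or.inr hq) hqm hc2) (Or.inl (Or.inl hs1m))
      (Or.inr hs2m) with (⟨t, ht, h⟩ | h) | ⟨t, ht, h⟩
    · rw [hγ h] at ht
      exact hw1 (congrArg γ (le_antisymm ht.2 hs'.1))
    · exact hI s ⟨hs1.1.trans hs'.1, hs'.2.trans hs2.2⟩ h
    · rw [hγ h] at ht
      exact hw2 (congrArg γ (le_antisymm hs'.2 ht.1))
  rcases le_total s1 s2 with hs | hs
  · exact key s1 s2 hs1 hs2 hs hw1 hw2 hw
  · exact key s2 s1 hs2 hs1 hs hw2 hw1 fun K' hK' h h' => hw K' hK' h' h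

theorem HasCutPoints.range_eq_arcHull [T2Space T] (hT : HasCutPoints T) {p q : T} {γ : Path p q}
    (hγ : Function.Injective γ) : Set.range γ = arcHull p q :=
  (Set.subset_sInter fun _ hK => hT.range_subset hγ hK.1 hK.2.1 hK.2.2.1 hK.2.2.2).antisymm
    (arcHull_subset (isCompact_range γ.continuous).isClosed (isPreconnected_range γ.continuous)
      γ.source_mem_range γ.target_mem_range)

/-- `w` is the projection of `p` to the subtree `A`. -/
structure IsTreeProj (A : Set T) (p w : T) : Prop where
  mem : w ∈ A
  mem_arcHull : ∀ a ∈ A, w ∈ arcHull p a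
  eq_of_mem : ∀ a ∈ A, a ∈ arcHull p w → a = w

theorem IsTreeProj.eq_of_mem_self {A : Set T} {p w : T} (h : IsTreeProj A p w) (hp : p ∈ A) :
    w = p :=
  (h.eq_of_mem p hp (left_mem_arcHull _ _)).symm

variable [TopologicalSpace.MetrizableSpace T] [PathConnectedSpace T]

theorem HasCutPoints.isArcBetween_arcHull (hT : HasCutPoints T) {p q : T} (hpq : p ≠ q) :
    IsArcBetween p q (arcHull p q) := by
  let := TopologicalSpace.metrizableSpaceMetric T
  obtain ⟨γ, hγ⟩ := Path.exists_injective hpq (PathConnectedSpace.somePath p q)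
  exact ⟨γ, hγ, hT.range_eq_arcHull hγ⟩

theorem HasCutPoints.isPreconnected_arcHull (hT : HasCutPoints T) (p q : T) :
    IsPreconnected (arcHull p q) := by
  rcases eq_or_ne p q with rfl | h
  · rw [arcHull_self]
    exact isPreconnected_singleton
  · obtain ⟨γ, -, hγ⟩ := hT.isArcBetween_arcHull h
    rw [← hγ]
    exact isPreconnected_range γ.continuous

theorem HasCutPoints.arcHull_subset_arcHull (hT : HasCutPoints T) {p q w w' : T}
    (hw : w ∈ arcHull p q) (hw' : w' ∈ arcHull p q) : arcHull w w' ⊆ arcHull p q :=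
  arcHull_subset (isClosed_arcHull _ _) (hT.isPreconnected_arcHull _ _) hw hw'

theorem HasCutPoints.arcHull_subset_union (hT : HasCutPoints T) (p q r : T) :
    arcHull p r ⊆ arcHull p q ∪ arcHull q r :=
  arcHull_subset ((isClosed_arcHull _ _).union (isClosed_arcHull _ _))
    ((hT.isPreconnected_arcHull p q).union q (right_mem_arcHull _ _) (left_mem_arcHull _ _)
      (hT.isPreconnected_arcHull q r)) (Or.inl (left_mem_arcHull _ _))
    (Or.inr (right_mem_arcHull _ _))

/-- The projection is the point where a path from `p` first hits `A`. The path up to that time meets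
`A` only there, so any arc from `p` to `A`, being connected and contained in their union, passes
through it. -/
theorem HasCutPoints.exists_isTreeProj (hT : HasCutPoints T) {A : Set T} (hA : IsClosed A)
    (hAc : IsPreconnected A) (hAn : A.Nonempty) (p : T) : ∃ w, IsTreeProj A p w := by
  obtain ⟨a0, ha0⟩ := hAn
  let γ : Path p a0 := PathConnectedSpace.somePath p a0
  obtain ⟨t, htA, ht⟩ := (hA.preimage γ.continuous).isCompact.exists_isLeast
    ⟨1, by simpa using ha0⟩
  have hJc : IsClosed (γ '' Set.Icc 0 t) := (isCompact_Icc.image γ.continuous).isClosed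
  have hJ : IsPreconnected (γ '' Set.Icc 0 t) :=
    isPreconnected_Icc.image _ γ.continuous.continuousOn
  have hJA : ∀ z ∈ γ '' Set.Icc 0 t, z ∈ A → z = γ t := by
    rintro _ ⟨s, hs, rfl⟩ hsA
    rw [le_antisymm hs.2 (ht hsA)]
  have hp : p ∈ γ '' Set.Icc 0 t := ⟨0, ⟨le_rfl, unitInterval.nonneg'⟩, γ.source⟩
  have hw : γ t ∈ γ '' Set.Icc 0 t := ⟨t, ⟨unitInterval.nonneg', le_rfl⟩, rfl⟩
  refine ⟨γ t, htA, fun a ha => ?_, fun a ha haw => hJA a (arcHull_subset hJc hJ hp hw haw) ha⟩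
  obtain ⟨z, hz, hzJ, hzA⟩ := isPreconnected_closed_iff.1 (hT.isPreconnected_arcHull p a) _ _ hJc hA
    (arcHull_subset (hJc.union hA) (hJ.union (γ t) hw htA hAc) (Or.inl hp) (Or.inr ha))
    ⟨p, left_mem_arcHull _ _, hp⟩ ⟨a, right_mem_arcHull _ _, ha⟩
  rwa [← hJA z hzJ hzA]

/-- The arc from `p` to `w'` passes through `w` and is covered by the arcs `p p'` and `p' w'`; the
latter meets `A` only in `w'`. -/
theorem IsTreeProj.mem_arcHull_of_ne (hT : HasCutPoints T) {A : Set T} {p p' w w' : T}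
    (h : IsTreeProj A p w) (h' : IsTreeProj A p' w') (hne : w ≠ w') : w ∈ arcHull p p' :=
  (hT.arcHull_subset_union p p' w' (h.mem_arcHull w' h'.mem)).resolve_right fun hw =>
    hne (h'.eq_of_mem w h.mem hw)

theorem IsTreeProj.mem_arcHull_of_subset (hT : HasCutPoints T) {A A' : Set T} {p w w' : T}
    (hA : A ⊆ A') (h : IsTreeProj A p w) (h' : IsTreeProj A' p w') {a : T} (ha : a ∈ A) :
    w ∈ arcHull w' a := by
  rcases hT.arcHull_subset_union p w' a (h.mem_arcHull a ha) with hw | hw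
  · rw [h'.eq_of_mem w (hA h.mem) hw]
    exact left_mem_arcHull _ _
  · exact hw

end ArcHull

section TreeDist

variable {X : Type u} {Y : Type v} [MetricSpace X] [MetricSpace Y] {φ : X → Y}

/-- For `p ≠ q` the hull is the only arc from `p` to `q`. For `p = q` no injective path exists, and
the empty supremum agrees with the diameter of a point. -/
theorem treeDist_eq_ediam [PathConnectedSpace (FactorTree φ)] (hT : HasCutPoints (FactorTree φ)) (p q : FactorTree φ) :
    treeDist φ p q = Metric.ediam (arcHull p q) := by
  unfold treeDist
  apply le_antisymm
  · refine iSup₂_le fun A hA => iSup₂_le fun w hw => iSup₂_le fun w' hw' => ?_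
    obtain ⟨γ, hγ, rfl⟩ := hA
    rw [hT.range_eq_arcHull hγ] at hw hw'
    exact Metric.edist_le_ediam_of_mem hw hw'
  · rcases eq_or_ne p q with rfl | h
    · simp [arcHull_self]
    · refine Metric.ediam_le fun w hw w' hw' => ?_
      exact le_iSup₂_of_le _ (hT.isArcBetween_arcHull h) (le_iSup₂_of_le w hw
        (le_iSup₂_of_le w' hw' le_rfl))

end TreeDist
/-! ### Spherical caps -/

section Caps

variable {E : Type*} [NormedAddCommGroup E] [InnerProductSpace ℝ E]

theorem norm_cos_smul_add_sin_smul {a v : E} (ha : ‖a‖ = 1) (hv : ‖v‖ = 1) (hav : inner ℝ a v = 0)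
    (t : ℝ) : ‖Real.cos t • a + Real.sin t • v‖ = 1 := by
  have h : ‖Real.cos t • a + Real.sin t • v‖ ^ 2 = 1 := by
    rw [norm_add_sq_real, norm_smul, norm_smul, inner_smul_left, inner_smul_right, hav, ha, hv]
    simp
  exact (pow_eq_one_iff_of_nonneg (norm_nonneg _) two_ne_zero).1 h

/-- The great circle through `a` in the direction `v`. -/
noncomputable def greatCircle {a v : E} (ha : ‖a‖ = 1) (hv : ‖v‖ = 1) (hav : inner ℝ a v = 0)
    (t : ℝ) : Metric.sphere (0 : E) 1 :=
  ⟨Real.cos t • a + Real.sin t • v, by simpa using norm_cos_smul_add_sin_smul ha hv hav t⟩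

theorem inner_greatCircle {a v : E} (ha : ‖a‖ = 1) (hv : ‖v‖ = 1) (hav : inner ℝ a v = 0)
    (t : ℝ) : inner ℝ a (greatCircle ha hv hav t : E) = Real.cos t := by
  simp [greatCircle, inner_add_right, inner_smul_right, hav, ha]

theorem dist_greatCircle_le {a v : E} (ha : ‖a‖ = 1) (hv : ‖v‖ = 1) (hav : inner ℝ a v = 0)
    (s t : ℝ) : dist (greatCircle ha hv hav s) (greatCircle ha hv hav t) ≤ dist s t := by
  rw [Subtype.dist_eq, dist_eq_norm, Real.dist_eq]
  refine abs_le_of_sq_le_sq' ?_ (abs_nonneg _) |>.2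
  have h : (greatCircle ha hv hav s : E) - greatCircle ha hv hav t =
      (Real.cos s - Real.cos t) • a + (Real.sin s - Real.sin t) • v := by
    simp only [greatCircle]
    module
  rw [h, norm_add_sq_real, norm_smul, norm_smul, inner_smul_left, inner_smul_right, hav, ha, hv,
    sq_abs]
  simp only [mul_zero, add_zero, mul_one, Real.norm_eq_abs, sq_abs]
  have h1 := Real.one_sub_sq_div_two_le_cos (x := s - t)
  rw [Real.cos_sub] at h1
  nlinarith [Real.sin_sq_add_cos_sq s, Real.sin_sq_add_cos_sq t]

theorem exists_eq_greatCircle [FiniteDimensional ℝ E] (hE : 2 ≤ Module.finrank ℝ E)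
    (a s : Metric.sphere (0 : E) 1) :
    ∃ (v : E) (hv : ‖v‖ = 1) (hav : inner ℝ (a : E) v = 0),
      s = greatCircle (norm_eq_of_mem_sphere a) hv hav (Real.arccos (inner ℝ (a : E) s)) := by
  have ha : ‖(a : E)‖ = 1 := norm_eq_of_mem_sphere a
  have hs : ‖(s : E)‖ = 1 := norm_eq_of_mem_sphere s
  have hle : |inner ℝ (a : E) s| ≤ 1 := by simpa [ha, hs] using abs_real_inner_le_norm (a : E) s
  have hcos := Real.cos_arccos (abs_le.1 hle).1 (abs_le.1 hle).2
  have hsin := Real.sin_arccos (inner ℝ (a : E) s)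
  have hsq : 0 ≤ 1 - inner ℝ (a : E) s ^ 2 := by
    have := (sq_le_one_iff_abs_le_one _).2 hle
    linarith
  have hsin2 : Real.sin (Real.arccos (inner ℝ (a : E) s)) ^ 2 = 1 - inner ℝ (a : E) s ^ 2 := by
    rw [hsin, Real.sq_sqrt hsq]
  set t := Real.arccos (inner ℝ (a : E) s)
  let u : E := s - Real.cos t • (a : E)
  have hau : inner ℝ (a : E) u = 0 := by
    simp [u, inner_sub_right, inner_smul_right, ha, hcos]
  have hu : ‖u‖ ^ 2 = Real.sin t ^ 2 := by
    rw [hsin2, norm_sub_sq_real, norm_smul, inner_smul_right, real_inner_comm, ha, hs, hcos,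
      Real.norm_eq_abs, mul_one, sq_abs]
    ring
  have hun : ‖u‖ = Real.sin t :=
    (sq_eq_sq₀ (norm_nonneg u) (hsin ▸ Real.sqrt_nonneg _)).1 hu
  rcases eq_or_ne u 0 with h0 | h0
  -- Here `s = ± a`, and any unit vector orthogonal to `a` serves; this needs dimension at least
  -- two.
  · have hs0 : Real.sin t = 0 := by rw [← hun, h0, norm_zero]
    have _ : Fact (Module.finrank ℝ E = (Module.finrank ℝ E - 1) + 1) := ⟨by omega⟩
    have hfr : Module.finrank ℝ (ℝ ∙ (a : E))ᗮ = Module.finrank ℝ E - 1 :=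
      Submodule.finrank_orthogonal_span_singleton (fun h => by simp [h] at ha)
    have : Nontrivial (ℝ ∙ (a : E))ᗮ := Module.nontrivial_of_finrank_pos (R := ℝ) (by omega)
    obtain ⟨⟨w, hw⟩, hw0⟩ := exists_ne (0 : (ℝ ∙ (a : E))ᗮ)
    have hw0' : ‖w‖ ≠ 0 := by simpa using hw0
    rw [Submodule.mem_orthogonal_singleton_iff_inner_right] at hw
    refine ⟨‖w‖⁻¹ • w, by rw [norm_smul, norm_inv, norm_norm, inv_mul_cancel₀ hw0'],
      by rw [inner_smul_right, hw, mul_zero], Subtype.ext ?_⟩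
    simp only [greatCircle, hs0, zero_smul, add_zero]
    exact sub_eq_zero.1 h0
  · have hs0 : Real.sin t ≠ 0 := by rw [← hun]; exact norm_ne_zero_iff.2 h0
    refine ⟨(Real.sin t)⁻¹ • u, ?_, by rw [inner_smul_right, hau, mul_zero], Subtype.ext ?_⟩
    · rw [← hun, norm_smul, norm_inv, norm_norm, inv_mul_cancel₀ (norm_ne_zero_iff.2 h0)]
    · simp only [greatCircle]
      rw [smul_smul, mul_inv_cancel₀ hs0, one_smul]
      simp [u]

/-- The spherical cap of angular radius `π * ρ` about `a`. -/
def sphericalCap (a : Metric.sphere (0 : E) 1) (ρ : ℝ) : Set (Metric.sphere (0 : E) 1) :=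
  {s | Real.cos (Real.pi * ρ) ≤ inner ℝ (a : E) s}

theorem isClosed_sphericalCap (a : Metric.sphere (0 : E) 1) (ρ : ℝ) : IsClosed (sphericalCap a ρ) :=
  isClosed_le continuous_const (by fun_prop)

theorem center_mem_sphericalCap (a : Metric.sphere (0 : E) 1) (ρ : ℝ) : a ∈ sphericalCap a ρ := by
  have ha : ‖(a : E)‖ = 1 := norm_eq_of_mem_sphere a
  change Real.cos _ ≤ inner ℝ (a : E) a
  rw [real_inner_self_eq_norm_sq, ha, one_pow]
  exact Real.cos_le_one _

theorem sphericalCap_zero (a : Metric.sphere (0 : E) 1) : sphericalCap a 0 = {a} := by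
  refine Set.Subset.antisymm (fun s hs => ?_)
    (Set.singleton_subset_iff.2 (center_mem_sphericalCap a 0))
  have ha : ‖(a : E)‖ = 1 := norm_eq_of_mem_sphere a
  have hsn : ‖(s : E)‖ = 1 := norm_eq_of_mem_sphere s
  have h1 : 1 ≤ inner ℝ (a : E) s := by simpa [sphericalCap] using hs
  have h2 : inner ℝ (a : E) s ≤ 1 := by simpa [ha, hsn] using real_inner_le_norm (a : E) s
  exact Subtype.ext ((inner_eq_one_iff_of_norm_eq_one ha hsn).1 (le_antisymm h2 h1)).symm

theorem sphericalCap_one (a : Metric.sphere (0 : E) 1) : sphericalCap a 1 = Set.univ := by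
  refine Set.eq_univ_of_forall fun s => ?_
  have ha : ‖(a : E)‖ = 1 := norm_eq_of_mem_sphere a
  have hsn : ‖(s : E)‖ = 1 := norm_eq_of_mem_sphere s
  have h := abs_real_inner_le_norm (a : E) s
  rw [ha, hsn, mul_one] at h
  simpa [sphericalCap] using (abs_le.1 h).1

theorem sphericalCap_mono (a : Metric.sphere (0 : E) 1) {ρ ρ' : ℝ} (h0 : 0 ≤ ρ) (h : ρ ≤ ρ')
    (h1 : ρ' ≤ 1) :
    sphericalCap a ρ ⊆ sphericalCap a ρ' := fun _ hs =>
  (Real.cos_le_cos_of_nonneg_of_le_pi (mul_nonneg Real.pi_pos.le h0)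
    (by nlinarith [Real.pi_pos]) (by gcongr)).trans hs

theorem greatCircle_mem_sphericalCap {a : Metric.sphere (0 : E) 1} {v : E} (hv : ‖v‖ = 1)
    (hav : inner ℝ (a : E) v = 0) {ρ t : ℝ} (h0 : 0 ≤ t) (ht : t ≤ Real.pi * ρ) (hρ : ρ ≤ 1) :
    greatCircle (norm_eq_of_mem_sphere a) hv hav t ∈ sphericalCap a ρ := by
  change _ ≤ inner ℝ (a : E) _
  rw [inner_greatCircle]
  exact Real.cos_le_cos_of_nonneg_of_le_pi h0 (by nlinarith [Real.pi_pos]) ht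

theorem arccos_le_of_mem_sphericalCap {a s : Metric.sphere (0 : E) 1} {ρ : ℝ} (h0 : 0 ≤ ρ)
    (h1 : ρ ≤ 1)
    (hs : s ∈ sphericalCap a ρ) : Real.arccos (inner ℝ (a : E) s) ≤ Real.pi * ρ := by
  rw [← Real.arccos_cos (mul_nonneg Real.pi_pos.le h0) (by nlinarith [Real.pi_pos])]
  exact Real.arccos_le_arccos hs

variable [FiniteDimensional ℝ E]

theorem isPreconnected_sphericalCap (hE : 2 ≤ Module.finrank ℝ E) (a : Metric.sphere (0 : E) 1)
    {ρ : ℝ} (h0 : 0 ≤ ρ)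
    (h1 : ρ ≤ 1) : IsPreconnected (sphericalCap a ρ) := by
  refine isPreconnected_of_forall a fun s hs => ?_
  obtain ⟨v, hv, hav, h⟩ := exists_eq_greatCircle hE a s
  have hle := arccos_le_of_mem_sphericalCap h0 h1 hs
  have ha : ‖(a : E)‖ = 1 := norm_eq_of_mem_sphere a
  have hc : Continuous (greatCircle ha hv hav) := by
    refine Continuous.subtype_mk ?_ _
    fun_prop
  refine ⟨greatCircle ha hv hav '' Set.Icc 0 (Real.arccos (inner ℝ (a : E) s)), ?_, ⟨0, ?_, ?_⟩,
    ⟨_, Set.right_mem_Icc.2 (Real.arccos_nonneg _), h.symm⟩,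
    isPreconnected_Icc.image _ hc.continuousOn⟩
  · rintro _ ⟨t, ht, rfl⟩
    exact greatCircle_mem_sphericalCap hv hav ht.1 (ht.2.trans hle) h1
  · exact Set.left_mem_Icc.2 (Real.arccos_nonneg _)
  · ext
    simp [greatCircle]

/-- Move `s` towards `a` along a great circle until it enters the smaller cap; the chord is at most
the arc. -/
theorem exists_mem_sphericalCap_dist_le (hE : 2 ≤ Module.finrank ℝ E) (a : Metric.sphere (0 : E) 1)
    {ρ ρ' : ℝ}
    (h0 : 0 ≤ ρ) (h : ρ ≤ ρ') (h1 : ρ' ≤ 1) {s : Metric.sphere (0 : E) 1}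
    (hs : s ∈ sphericalCap a ρ') :
    ∃ s' ∈ sphericalCap a ρ, dist s s' ≤ Real.pi * (ρ' - ρ) := by
  obtain ⟨v, hv, hav, hsv⟩ := exists_eq_greatCircle hE a s
  have hle := arccos_le_of_mem_sphericalCap (h0.trans h) h1 hs
  have ha : ‖(a : E)‖ = 1 := norm_eq_of_mem_sphere a
  have hnn := Real.arccos_nonneg (inner ℝ (a : E) s)
  have hpi := Real.pi_pos
  set t := Real.arccos (inner ℝ (a : E) s)
  refine ⟨greatCircle ha hv hav (min t (Real.pi * ρ)), greatCircle_mem_sphericalCap hv hav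
    (le_min hnn (by positivity)) (min_le_right _ _) (h.trans h1), ?_⟩
  rw [hsv]
  refine (dist_greatCircle_le ha hv hav _ _).trans ?_
  rw [Real.dist_eq, abs_of_nonneg (sub_nonneg.2 (min_le_left _ _))]
  rcases min_cases t (Real.pi * ρ) with ⟨e, -⟩ | ⟨e, -⟩
  · rw [e, sub_self]
    exact mul_nonneg hpi.le (sub_nonneg.2 h)
  · rw [e, mul_sub]
    linarith

end Caps
/-! ### The extension theorem -/

theorem PropertyT.hasCutPoints {X : Type u} {Y : Type v} [MetricSpace X] [MetricSpace Y]
    {C : ℝ≥0} (hX : QuasiConvexSpace C X) (hH : SingularH1Vanishes X ∨ LipschitzH1Vanishes X)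
    {φ : X → Y} (hφ : Continuous φ) (hT : PropertyT φ) : HasCutPoints (FactorTree φ) :=
  fun _ hK hKn => hT.exists_cut_point hX hH hφ hK hKn

theorem pathConnectedSpace_factorTree {X : Type u} {Y : Type v} [MetricSpace X] [MetricSpace Y]
    {C : ℝ≥0} (hX : QuasiConvexSpace C X) [Nonempty X] {φ : X → Y} (hφ : Continuous φ) :
    PathConnectedSpace (FactorTree φ) := by
  have : PathConnectedSpace X := ⟨‹_›, fun x x' => ⟨(hX x x').choose⟩⟩
  exact (treeMap_surjective φ).pathConnectedSpace (continuous_treeMap hX hφ)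

/-- The difference of the vectors and the difference of the norms each contribute `2 * ‖x - x'‖`,
because `‖x‖⁻¹ ≤ 2`. The constant `4` is below `2π`. -/
theorem dist_radial_le {E : Type*} [NormedAddCommGroup E] [NormedSpace ℝ E] {x x' : E}
    (hx : 1 / 2 ≤ ‖x‖) (hxx' : ‖x‖ ≤ ‖x'‖) :
    ‖(‖x‖⁻¹ • x) - ‖x'‖⁻¹ • x'‖ ≤ 4 * ‖x - x'‖ := by
  have h0 : 0 < ‖x‖ := by linarith
  have h0' : 0 < ‖x'‖ := by linarith
  have h1 : (‖x‖⁻¹ • x) - ‖x'‖⁻¹ • x' = ‖x‖⁻¹ • (x - x') + (‖x‖⁻¹ - ‖x'‖⁻¹) • x' := by module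
  have h2 : ‖(‖x‖⁻¹ - ‖x'‖⁻¹) • x'‖ = ‖x‖⁻¹ * (‖x'‖ - ‖x‖) := by
    rw [norm_smul, Real.norm_of_nonneg (sub_nonneg.2 (inv_anti₀ h0 hxx'))]
    field_simp
  have h3 : ‖x'‖ - ‖x‖ ≤ ‖x - x'‖ := by
    rw [norm_sub_rev]
    exact norm_sub_norm_le _ _
  have h4 : ‖x‖⁻¹ ≤ 2 := by
    rw [inv_le_comm₀ h0 two_pos]
    linarith
  rw [h1]
  refine (norm_add_le _ _).trans ?_
  rw [h2, norm_smul, norm_inv, norm_norm]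
  nlinarith [norm_nonneg (x - x'), inv_pos.2 h0]

/-- Extension of a map from the sphere into a tree to the ball: the point `r • s` is mapped to the
projection of `f s` to the image of a spherical cap whose radius grows with `r`. -/
theorem HasCutPoints.exists_extension {T : Type u} [EMetricSpace T] [PathConnectedSpace T]
    (hT : HasCutPoints T) {E : Type*} [NormedAddCommGroup E] [InnerProductSpace ℝ E]
    [FiniteDimensional ℝ E] (hE : 2 ≤ Module.finrank ℝ E) {σ : ℝ≥0 → ℝ≥0} (hσ : IsModulus σ)
    (L : ℝ≥0) (f : Metric.sphere (0 : E) 1 → T)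
    (hf : ∀ s s', Metric.ediam (arcHull (f s) (f s')) ≤ (σ (L * nndist s s') : ℝ≥0)) :
    ∃ F : Metric.closedBall (0 : E) 1 → T,
      (∀ s, F ⟨s.1, Metric.sphere_subset_closedBall s.2⟩ = f s) ∧ Set.range F = Set.range f ∧
      ∀ x x', Metric.ediam (arcHull (F x) (F x')) ≤
        2 * (σ (2 * NNReal.pi * L * nndist x x') : ℝ≥0) := by
  classical
  have hσm {a b : ℝ≥0} (h : a ≤ b) : ((σ a : ℝ≥0) : ℝ≥0∞) ≤ σ b := by
    exact_mod_cast hσ.strictMono.monotone h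
  have hfc : Continuous f := by
    refine continuous_iff_continuousAt.2 fun s => tendsto_iff_edist_tendsto_0.2 ?_
    have h : Filter.Tendsto (fun s' => ((σ (L * nndist s' s) : ℝ≥0) : ℝ≥0∞)) (nhds s)
        (nhds 0) := by
      have hc : Continuous fun s' => ((σ (L * nndist s' s) : ℝ≥0) : ℝ≥0∞) := by
        have := hσ.continuous
        fun_prop
      simpa [hσ.map_zero] using hc.tendsto s
    exact tendsto_of_tendsto_of_tendsto_of_le_of_le tendsto_const_nhds h (fun _ => bot_le)
      fun s' => (Metric.edist_le_ediam_of_mem (left_mem_arcHull _ _)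
        (right_mem_arcHull _ _)).trans (hf s' s)
  have hnt : Nontrivial E := Module.nontrivial_of_finrank_pos (R := ℝ) (by omega)
  obtain ⟨a⟩ : Nonempty (Metric.sphere (0 : E) 1) :=
    (NormedSpace.sphere_nonempty.2 zero_le_one).to_subtype
  let A : ℝ → Set T := fun ρ => f '' sphericalCap a ρ
  have hproj (ρ : Set.Icc (0 : ℝ) 1) (s : Metric.sphere (0 : E) 1) :
      ∃ w, IsTreeProj (A ρ) (f s) w :=
    hT.exists_isTreeProj ((isClosed_sphericalCap a ρ).isCompact.image hfc).isClosed
      ((isPreconnected_sphericalCap hE a ρ.2.1 ρ.2.2).image _ hfc.continuousOn)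
      ⟨f a, a, center_mem_sphericalCap a ρ, rfl⟩ _
  choose G hG using hproj
  have hG0 (ρ : Set.Icc (0 : ℝ) 1) (hρ : ρ.1 = 0) (s) : G ρ s = f a := by
    obtain ⟨s', hs', h⟩ := (hG ρ s).mem
    rw [hρ, sphericalCap_zero] at hs'
    rw [← h, Set.mem_singleton_iff.1 hs']
  have hG1 (ρ : Set.Icc (0 : ℝ) 1) (hρ : ρ.1 = 1) (s) : G ρ s = f s :=
    (hG ρ s).eq_of_mem_self ⟨s, by simp [hρ, sphericalCap_one], rfl⟩
  -- Angular estimate: distinct projections both lie on the arc from `f s` to `f s'`.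
  have hang (ρ : Set.Icc (0 : ℝ) 1) (s s') :
      Metric.ediam (arcHull (G ρ s) (G ρ s')) ≤ (σ (L * nndist s s') : ℝ≥0) := by
    rcases eq_or_ne (G ρ s) (G ρ s') with h | h
    · simp [h, arcHull_self]
    · refine (Metric.ediam_mono (hT.arcHull_subset_arcHull
        ((hG ρ s).mem_arcHull_of_ne hT (hG ρ s') h) ?_)).trans (hf s s')
      rw [arcHull_comm]
      exact (hG ρ s').mem_arcHull_of_ne hT (hG ρ s) h.symm
  -- Radial estimate: write the outer projection as `f s'` and push `s'` to a point `s''` of the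
  -- smaller cap. The inner projection lies on the arc from `f s'` to `f s''`.
  have hrad (ρ ρ' : Set.Icc (0 : ℝ) 1) (hρ : ρ.1 ≤ ρ'.1) (s) (r : ℝ≥0)
      (hr : Real.pi * (ρ'.1 - ρ.1) ≤ r) :
      Metric.ediam (arcHull (G ρ s) (G ρ' s)) ≤ (σ (L * r) : ℝ≥0) := by
    obtain ⟨s', hs', hs'G⟩ := (hG ρ' s).mem
    obtain ⟨s'', hs'', hd⟩ := exists_mem_sphericalCap_dist_le hE a ρ.2.1 hρ ρ'.2.2 hs'
    have hmem := (hG ρ s).mem_arcHull_of_subset hT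
      (Set.image_mono (sphericalCap_mono a ρ.2.1 hρ ρ'.2.2)) (hG ρ' s)
      (Set.mem_image_of_mem f hs'')
    refine (Metric.ediam_mono (hT.arcHull_subset_arcHull hmem (left_mem_arcHull _ _))).trans ?_
    rw [← hs'G]
    refine (hf s' s'').trans (hσm ?_)
    gcongr
    exact_mod_cast hd.trans hr
  -- The map is constant on the ball of radius `1/2`, so the choice of direction at the origin is
  -- harmless; the slope `2` outside it produces the factor `2π`.
  let ρ : Metric.closedBall (0 : E) 1 → Set.Icc (0 : ℝ) 1 := fun x =>
    ⟨max 0 (2 * ‖(x : E)‖ - 1), le_max_left _ _, max_le zero_le_one (by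
      have := mem_closedBall_zero_iff.1 x.2
      linarith)⟩
  let dir : Metric.closedBall (0 : E) 1 → Metric.sphere (0 : E) 1 := fun x =>
    if h : (x : E) = 0 then a else ⟨‖(x : E)‖⁻¹ • (x : E), by
      rw [mem_sphere_zero_iff_norm, norm_smul, norm_inv, norm_norm,
        inv_mul_cancel₀ (norm_ne_zero_iff.2 h)]⟩
  have hF1 (s : Metric.sphere (0 : E) 1) :
      G (ρ ⟨s.1, Metric.sphere_subset_closedBall s.2⟩)
        (dir ⟨s.1, Metric.sphere_subset_closedBall s.2⟩) = f s := by
    have hs : ‖(s : E)‖ = 1 := norm_eq_of_mem_sphere s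
    have hs0 : (s : E) ≠ 0 := fun h => by simp [h] at hs
    rw [hG1 _ (by simp [ρ, hs]; norm_num)]
    congr 1
    simp only [dir, hs0, dite_false, hs, inv_one, one_smul]
  have hmain (x x' : Metric.closedBall (0 : E) 1) (hxx' : ‖(x : E)‖ ≤ ‖(x' : E)‖) :
      Metric.ediam (arcHull (G (ρ x) (dir x)) (G (ρ x') (dir x'))) ≤
        2 * (σ (2 * NNReal.pi * L * nndist x x') : ℝ≥0) := by
    have hnn : ((nndist x x' : ℝ≥0) : ℝ) = ‖(x : E) - x'‖ := by
      rw [coe_nndist, Subtype.dist_eq, dist_eq_norm]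
    have hsub : ‖(x' : E)‖ - ‖(x : E)‖ ≤ ‖(x : E) - x'‖ := by
      rw [norm_sub_rev]
      exact norm_sub_norm_le _ _
    have hρρ' : (ρ x).1 ≤ (ρ x').1 := max_le_max le_rfl (by linarith)
    have hρle : (ρ x').1 - (ρ x).1 ≤ 2 * ‖(x : E) - x'‖ := by
      rw [sub_le_iff_le_add]
      have h0 := norm_nonneg ((x : E) - x')
      refine max_le (add_nonneg (by linarith) (ρ x).2.1) ?_
      have : 2 * ‖(x : E)‖ - 1 ≤ (ρ x).1 := le_max_right _ _
      linarith
    have hR (s) : Metric.ediam (arcHull (G (ρ x) s) (G (ρ x') s)) ≤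
        (σ (2 * NNReal.pi * L * nndist x x') : ℝ≥0) := by
      have := hrad (ρ x) (ρ x') hρρ' s (2 * NNReal.pi * nndist x x') (by
        rw [NNReal.coe_mul, hnn]
        simp only [NNReal.coe_mul, NNReal.coe_ofNat, NNReal.coe_real_pi]
        nlinarith [Real.pi_pos])
      convert! this using 3
      ring
    rcases lt_or_ge ‖(x : E)‖ (1 / 2) with hx | hx
    -- At `ρ = 0` the direction is irrelevant, so `dir x` may be replaced by `dir x'` and only the
    -- radial term remains.
    · rw [hG0 (ρ x) (max_eq_left (by linarith)) (dir x),
        ← hG0 (ρ x) (max_eq_left (by linarith)) (dir x')]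
      refine (hR _).trans ?_
      exact le_mul_of_one_le_left bot_le one_le_two
    -- Turn at the smaller radius first, then move radially.
    · refine (Metric.ediam_mono (hT.arcHull_subset_union _ (G (ρ x) (dir x')) _)).trans ?_
      refine (Metric.ediam_union_le ⟨G (ρ x) (dir x'), right_mem_arcHull _ _,
        left_mem_arcHull _ _⟩).trans ?_
      rw [two_mul]
      refine add_le_add ((hang _ _ _).trans (hσm ?_)) (hR _)
      have hx0 : (x : E) ≠ 0 := norm_pos_iff.1 (by linarith)
      have hx0' : (x' : E) ≠ 0 := norm_pos_iff.1 (by linarith)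
      have hd : nndist (dir x) (dir x') ≤ 2 * NNReal.pi * nndist x x' := by
        rw [← NNReal.coe_le_coe, NNReal.coe_mul, hnn, coe_nndist, Subtype.dist_eq, dist_eq_norm]
        simp only [dir, hx0, hx0', dite_false, NNReal.coe_mul, NNReal.coe_ofNat,
          NNReal.coe_real_pi]
        refine (dist_radial_le hx hxx').trans ?_
        nlinarith [Real.pi_gt_three, norm_nonneg ((x : E) - x')]
      calc L * nndist (dir x) (dir x') ≤ L * (2 * NNReal.pi * nndist x x') := by gcongr
        _ = _ := by ring
  refine ⟨fun x => G (ρ x) (dir x), hF1, Set.Subset.antisymm ?_ ?_, fun x x' => ?_⟩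
  · rintro _ ⟨x, rfl⟩
    obtain ⟨s, -, h⟩ := (hG (ρ x) (dir x)).mem
    exact ⟨s, h⟩
  · rintro _ ⟨s, rfl⟩
    exact ⟨_, hF1 s⟩
  · rcases le_total ‖(x : E)‖ ‖(x' : E)‖ with h | h
    · exact hmain x x' h
    · rw [arcHull_comm, nndist_comm]
      exact hmain x' x h

theorem mainTheorem7 {X : Type u} {Y : Type v} [MetricSpace X] [MetricSpace Y]
    (C : ℝ≥0) (hX : QuasiConvexSpace C X)
    (hH : SingularH1Vanishes X ∨ LipschitzH1Vanishes X)
    (σ : ℝ≥0 → ℝ≥0) (hσ : IsModulus σ)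
    (φ : X → Y) (hφ : SigmaContinuous σ φ) (hT : PropertyT φ)
    (m : ℕ) (hm : 2 ≤ m) (L : ℝ≥0)
    (f : Metric.sphere (0 : EuclideanSpace ℝ (Fin m)) 1 → FactorTree φ)
    (hf : ∀ s s', treeDist φ (f s) (f s') ≤ (σ (L * nndist s s') : ℝ≥0)) :
    ∃ F : Metric.closedBall (0 : EuclideanSpace ℝ (Fin m)) 1 → FactorTree φ,
      (∀ s, F ⟨s.1, Metric.sphere_subset_closedBall s.2⟩ = f s) ∧
      Set.range F = Set.range f ∧
      ∀ x x', treeDist φ (F x) (F x') ≤ 2 * (σ (2 * NNReal.pi * L * nndist x x') : ℝ≥0) := by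
  have hm' : 2 ≤ Module.finrank ℝ (EuclideanSpace ℝ (Fin m)) := by simpa using hm
  have hφc := hφ.continuous hσ
  have hnt : Nontrivial (EuclideanSpace ℝ (Fin m)) :=
    Module.nontrivial_of_finrank_pos (R := ℝ) (by omega)
  obtain ⟨s⟩ : Nonempty (Metric.sphere (0 : EuclideanSpace ℝ (Fin m)) 1) :=
    (NormedSpace.sphere_nonempty.2 zero_le_one).to_subtype
  have : Nonempty X := ⟨(treeMap_surjective φ (f s)).choose⟩
  have := pathConnectedSpace_factorTree hX hφc
  have hcut := hT.hasCutPoints hX hH hφc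
  simp only [treeDist_eq_ediam hcut] at hf ⊢
  exact hcut.exists_extension hm' hσ L f hf
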